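/- Let $S\in\{\tfrac12,1,\tfrac32,\dots\}$ and let $S^{(1)},S^{(2)},S^{(3)}$ be the usual spin operators on $\mathbb C^{2S+1}$. On $(\mathbb C^{2S+1})^{\otimes n}$ write $S^{(a)}_i$ for $S^{(a)}$ acting on the $i$-th factor, and let $$H_n=-\frac2n\sum_{1\le i<j\le n}\big(S^{(1)}_iS^{(1)}_j+S^{(2)}_iS^{(2)}_j+S^{(3)}_iS^{(3)}_j\big),\qquad W_n(\beta,h)=\exp\Big(-\beta H_n+h\sum_{i=1}^nS^{(1)}_i\Big).$$ For $\beta>0$, $h\in\mathbb R$ define the pressure $p(\beta,h)=\lim_{n\to\infty}\frac1n\log\operatorname{Tr}W_n(\beta,h)$, the magnetization $m(\beta,h)=\partial p/\partial h$, the susceptibility $\chi(\beta)=\partial m/\partial h|_{h=0}$, and $$\chi^\perp_n(\beta,h)=\frac1n\sum_{1\le i<j\le n}\frac{\operatorname{Tr}\big(S^{(2)}_iS^{(2)}_jW_n(\beta,h)\big)}{\operatorname{Tr}W_n(\beta,h)}.$$ Let $\eta(x)=\log\frac{\sinh((2S+1)x/2)}{\sinh(x/2)}$ with $\eta(0)=\log(2S+1)$;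 for $0\le m<S$ let $x^\star(m)$ be the unique solution of $\eta'(x)=m$ and put $g_\beta(m)=\eta(x^\star(m))-m\,x^\star(m)+\beta m^2$, extended continuously to $m=S$ by $g_\beta(S)=\beta S^2$. Let $m^\star(\beta)$ be the maximiser of $g_\beta$ on $[0,S]$, and $\beta_c=\frac{3/2}{S^2+S}$. Write $f\sim u$ if $f/u$ converges to a positive constant. (i) For all $\beta>0$ and $h\in\mathbb R$ the limit $p(\beta,h)$ exists and $$p(\beta,h)=\max_{0\le m\le S}\big(g_\beta(m)+|h|\,m\big);$$ in particular $p(\beta,h)=\max_{0\le m\le S}(g_\beta(m)+hm)$ for $h\ge0$. (ii) For every $\beta>0$ the maximiser $m^\star(\beta)$ exists, is unique and lies in $[0,S)$; $p(\beta,\cdot)$ is differentiable at $h$ whenever $h\ne0$ or $\beta\le\beta_c$; and $m(\beta,\cdot)$ is differentiable at $0$ when $\beta<\beta_c$. Moreover $$m^\star(\beta)\sim(\beta-\beta_c)^{1/2}\ \ (\beta\downarrow\beta_c),\qquad \chi(\beta)\sim(\beta_c-\beta)^{-1}\ \ (\beta\uparrow\beta_c),\qquad m(\beta_c,h)\sim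 h^{1/3}\ \ (h\downarrow0).$$ (iii) For all $\beta,h>0$ the sequence $(\chi^\perp_n(\beta,h))_n$ has a convergent subsequence. If, for every $h>0$, $\chi^\perp(\beta,h)$ is any limit of $\chi^\perp_n(\beta,h)$ along a subsequence (which may depend on $\beta$ and $h$), then $$\chi^\perp(\beta_c,h)\sim h^{-2/3}\ \ (h\downarrow0),\qquad\text{and, for every }\beta>\beta_c,\quad \chi^\perp(\beta,h)\sim h^{-1}\ \ (h\downarrow0).$$ -/

import Mathlib

open Filter Topology

noncomputable section

namespace Heisenberg

/-- The spin quantum number `S = d / 2`; throughout, `d = 2 S` is a natural number. -/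
def spin (d : ℕ) : ℝ := (d : ℝ) / 2

/-- The eigenvalue `S - k` of the third spin operator on the `k`-th basis vector of `ℂ^(2S+1)`. -/
def weight (d : ℕ) (k : Fin (d + 1)) : ℝ := spin d - (k : ℕ)

/-- The raising operator `S⁺` on `ℂ^(2S+1)`: it maps the weight vector `|m⟩` to
`√(S (S + 1) - m (m + 1)) |m + 1⟩`. -/
def spinRaise (d : ℕ) : Matrix (Fin (d + 1)) (Fin (d + 1)) ℂ :=
  Matrix.of fun k l =>
    if (k : ℕ) + 1 = (l : ℕ) then
      ((Real.sqrt (spin d * (spin d + 1) - weight d l * (weight d l + 1)) : ℝ) : ℂ)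
    else 0

/-- The spin operator `S^(1) = (S⁺ + S⁻) / 2`, where `S⁻` is the adjoint of `S⁺`. -/
def spin1 (d : ℕ) : Matrix (Fin (d + 1)) (Fin (d + 1)) ℂ :=
  (1 / 2 : ℂ) • (spinRaise d + (spinRaise d).conjTranspose)

/-- The spin operator `S^(2) = (S⁺ - S⁻) / (2 i)`. -/
def spin2 (d : ℕ) : Matrix (Fin (d + 1)) (Fin (d + 1)) ℂ :=
  (1 / (2 * Complex.I)) • (spinRaise d - (spinRaise d).conjTranspose)

/-- The spin operator `S^(3)`, diagonal with entries `S, S - 1, …, -S`. -/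
def spin3 (d : ℕ) : Matrix (Fin (d + 1)) (Fin (d + 1)) ℂ :=
  Matrix.diagonal fun k => ((weight d k : ℝ) : ℂ)

/-- The index set of the product basis of the `n`-fold tensor power of `ℂ^(2S+1)`. -/
abbrev Config (d n : ℕ) : Type := Fin n → Fin (d + 1)

/-- The operator `1 ⊗ ⋯ ⊗ A ⊗ ⋯ ⊗ 1` with `A` in the `i`-th factor, in the product basis. -/
def site {d n : ℕ} (A : Matrix (Fin (d + 1)) (Fin (d + 1)) ℂ) (i : Fin n) :
    Matrix (Config d n) (Config d n) ℂ :=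
  Matrix.of fun σ τ => if ∀ k, k ≠ i → σ k = τ k then A (σ i) (τ i) else 0

/-- The isotropic Heisenberg Hamiltonian on the complete graph with `n` vertices,
`-(2/n) ∑_{i<j} (S_i^(1) S_j^(1) + S_i^(2) S_j^(2) + S_i^(3) S_j^(3))`. -/
def hamiltonian (d n : ℕ) : Matrix (Config d n) (Config d n) ℂ :=
  (-(2 / (n : ℂ))) • ∑ i : Fin n, ∑ j ∈ Finset.Ioi i,
    (site (spin1 d) i * site (spin1 d) j + site (spin2 d) i * site (spin2 d) j
      + site (spin3 d) i * site (spin3 d) j)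

/-- The operator `exp (-β H_n + h ∑_i S_i^(1))`. -/
def gibbs (d n : ℕ) (β h : ℝ) : Matrix (Config d n) (Config d n) ℂ :=
  NormedSpace.exp ((-(β : ℂ)) • hamiltonian d n + (h : ℂ) • ∑ i : Fin n, site (spin1 d) i)

/-- The finite-volume pressure `(1/n) log Tr exp (-β H_n + h ∑_i S_i^(1))`
(the trace is real and positive). -/
def finitePressure (d n : ℕ) (β h : ℝ) : ℝ :=
  1 / (n : ℝ) * Real.log (gibbs d n β h).trace.re

/-- The pressure `p(β, h)`, the limit of the finite-volume pressures. -/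
def pressure (d : ℕ) (β h : ℝ) : ℝ :=
  limUnder atTop fun n : ℕ => finitePressure d n β h

/-- The magnetization `m(β, h) = ∂p/∂h`. -/
def magnetization (d : ℕ) (β h : ℝ) : ℝ := deriv (fun t => pressure d β t) h

/-- The susceptibility `χ(β) = ∂m/∂h` at `h = 0`. -/
def susceptibility (d : ℕ) (β : ℝ) : ℝ := deriv (fun t => magnetization d β t) 0

/-- The finite-volume transverse susceptibility
`(1/n) ∑_{i<j} Tr (S_i^(2) S_j^(2) e^{-β H_n + h ∑ S^(1)}) / Tr (e^{-β H_n + h ∑ S^(1)})`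
(each summand is real). -/
def finiteTransverse (d n : ℕ) (β h : ℝ) : ℝ :=
  1 / (n : ℝ) * ∑ i : Fin n, ∑ j ∈ Finset.Ioi i,
    ((site (spin2 d) i * site (spin2 d) j * gibbs d n β h).trace / (gibbs d n β h).trace).re

/-- `L` is a limit of the finite-volume transverse susceptibilities along some subsequence of
volumes. -/
def IsTransverseSusceptibility (d : ℕ) (β h L : ℝ) : Prop :=
  ∃ φ : ℕ → ℕ, StrictMono φ ∧ Tendsto (fun k => finiteTransverse d (φ k) β h) atTop (𝓝 L)

/-- `η(x) = log (sinh ((2S+1) x / 2) / sinh (x / 2))`, with `η(0) = log (2S+1)`. -/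
def eta (d : ℕ) (x : ℝ) : ℝ :=
  if x = 0 then Real.log (2 * spin d + 1)
  else Real.log (Real.sinh ((2 * spin d + 1) / 2 * x) / Real.sinh (1 / 2 * x))

/-- The solution `x` of `η'(x) = m`; it exists and is unique for `-S < m < S`. -/
def xStar (d : ℕ) (m : ℝ) : ℝ := Classical.epsilon fun x => deriv (eta d) x = m

/-- `g_β(m) = η(x⋆(m)) - m x⋆(m) + β m²` for `0 ≤ m < S`, extended to the endpoint `m = S` by
continuity: `η(x⋆(m)) - m x⋆(m)` tends to `0` as `m ↑ S`. -/
def g (d : ℕ) (β m : ℝ) : ℝ :=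
  if m < spin d then eta d (xStar d m) - m * xStar d m + β * m ^ 2 else β * m ^ 2

/-- `m` is a maximiser of `g_β` lying in `[0, S)`. -/
def IsMaximiser (d : ℕ) (β m : ℝ) : Prop :=
  m ∈ Set.Ico 0 (spin d) ∧ IsMaxOn (g d β) (Set.Icc 0 (spin d)) m

/-- The spontaneous magnetization `m⋆(β)`, the maximiser of `g_β`. -/
def mStar (d : ℕ) (β : ℝ) : ℝ := Classical.epsilon fun m => IsMaximiser d β m

/-- The critical inverse temperature `β_c = (3/2) / (S² + S)`. -/
def betaC (d : ℕ) : ℝ := (3 / 2) / (spin d ^ 2 + spin d)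

/-- `f ∼ u` along `l`: the quotient `f / u` converges to a positive constant. -/
def Sim (l : Filter ℝ) (f u : ℝ → ℝ) : Prop :=
  ∃ c : ℝ, 0 < c ∧ Tendsto (fun x => f x / u x) l (𝓝 c)

end Heisenberg

end

noncomputable section

namespace Heisenberg

/-! ### Hyperbolic inequalities -/

/-! On the complete graph the Hamiltonian is, up to a scalar, `-(1/n)` times the Casimir operator
`C` of the total spin (`smul_hamiltonian`). `C` commutes with every total spin component, so a
rotation about the second axis turns the field term into `|h|` times the diagonal total `S^(3)`, and
the partition function becomes a sum over configurations of a diagonal entry of `exp (tC)`, `t =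
β/n`, times `exp (|h| M)`, with `M` the total weight.

Those entries are estimated without decomposing the tensor power into irreducibles. Below: `C = S⁻S⁺
+ M(M+1)` gives entries at least `exp (t M(M+1))` (`diagExp_ge`), and bounding `M²` below by a
tangent line factorises the sum (`le_partitionSum`). Above: the sums over the levels `M = r` and `M
= r+1` differ by `exp (t r(r+1))` times the difference of the two level sizes (`levelSum_sub`), and
level sizes obey a Chernoff bound. There are only linearly many levels, so both bounds give the same
exponential rate.

In the variational problem, `m = η'(x)` makes the derivative of the objective equal to `η''(x) (h +
2βη'(x) - x)`. Since `η'` is strictly increasing and strictly concave on `[0, ∞)`, this changes sign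
once, at the largest solution of the mean-field equation `x = 2βη'(x) + h`. The maximum has the
maximiser as a subgradient in `h`, so the magnetization is `η'` at that solution. The exponents
follow from `η'(x) = x/(2β_c) - c x³ + o(x³)` with `c > 0`.

For the transverse susceptibility, `S^(2) + i S^(3)` is a ladder operator for `S^(1)`. Cyclicity of
the trace yields the exact Ward identity `trace_sq_mul_of_ladder`, whence `χ^⊥ = (1/4) coth (h/2) m`
up to an error bounded uniformly in `n` and `h`. -/

theorem pos_of_hasDerivAt_pos {f f' : ℝ → ℝ} (hf : ∀ x, HasDerivAt f (f' x) x) (h0 : f 0 = 0)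
    (hpos : ∀ x, 0 < x → 0 < f' x) {x : ℝ} (hx : 0 < x) : 0 < f x := by
  have hmono : StrictMonoOn f (Set.Ici 0) := by
    refine strictMonoOn_of_deriv_pos (convex_Ici 0)
      (fun y _ => (hf y).continuousAt.continuousWithinAt) fun y hy => ?_
    rw [interior_Ici] at hy
    rw [(hf y).deriv]
    exact hpos y hy
  simpa [h0] using hmono (Set.self_mem_Ici) hx.le hx

theorem sinh_lt_mul_cosh {x : ℝ} (hx : 0 < x) : Real.sinh x < x * Real.cosh x := by
  have h := pos_of_hasDerivAt_pos (f := fun y => y * Real.cosh y - Real.sinh y)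
    (f' := fun y => y * Real.sinh y)
    (fun y => by
      have := ((hasDerivAt_id y).mul (Real.hasDerivAt_cosh y)).sub (Real.hasDerivAt_sinh y)
      refine HasDerivAt.congr_deriv this ?_
      simp) (by simp) (fun y hy => mul_pos hy (Real.sinh_pos_iff.2 hy)) hx
  linarith

/-- Obtained by integrating `sinh_lt_mul_cosh` twice from the origin. At `2y`, the double-angle
formulas turn it into the sign of the derivative of `y³ cosh y / sinh³ y`, which governs `η'''`. -/
theorem three_mul_sinh_lt {x : ℝ} (hx : 0 < x) :
    3 * Real.sinh x < x * Real.cosh x + 2 * x := by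
  have h1 : ∀ y : ℝ, 0 < y → 0 < y * Real.sinh y + 2 - 2 * Real.cosh y := fun y hy =>
    pos_of_hasDerivAt_pos (f := fun y => y * Real.sinh y + 2 - 2 * Real.cosh y)
      (f' := fun y => y * Real.cosh y - Real.sinh y)
      (fun y => by
        have := (((hasDerivAt_id y).mul (Real.hasDerivAt_sinh y)).add_const 2).sub
          ((Real.hasDerivAt_cosh y).const_mul 2)
        refine HasDerivAt.congr_deriv this ?_
        simp; ring) (by simp) (fun y hy => by linarith [sinh_lt_mul_cosh hy]) hy
  have h := pos_of_hasDerivAt_pos (f := fun y => y * Real.cosh y + 2 * y - 3 * Real.sinh y)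
    (f' := fun y => y * Real.sinh y + 2 - 2 * Real.cosh y)
    (fun y => by
      have := (((hasDerivAt_id y).mul (Real.hasDerivAt_cosh y)).add
        ((hasDerivAt_id y).const_mul 2)).sub ((Real.hasDerivAt_sinh y).const_mul 3)
      refine HasDerivAt.congr_deriv this ?_
      simp; ring) (by simp) h1 hx
  linarith

theorem strictAntiOn_div_sinh : StrictAntiOn (fun y : ℝ => y / Real.sinh y) (Set.Ioi 0) := by
  have hd : ∀ y : ℝ, 0 < y → HasDerivAt (fun y : ℝ => y / Real.sinh y)
      ((1 * Real.sinh y - y * Real.cosh y) / Real.sinh y ^ 2) y := fun y hy =>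
    (hasDerivAt_id y).div (Real.hasDerivAt_sinh y) (Real.sinh_pos_iff.2 hy).ne'
  refine strictAntiOn_of_deriv_neg (convex_Ioi 0)
    (fun y hy => (hd y hy).continuousAt.continuousWithinAt) fun y hy => ?_
  rw [interior_Ioi] at hy
  rw [(hd y hy).deriv]
  have := Real.sinh_pos_iff.2 hy
  exact div_neg_of_neg_of_pos (by linarith [sinh_lt_mul_cosh hy]) (by positivity)

theorem strictAntiOn_cube_mul_cosh_div :
    StrictAntiOn (fun y : ℝ => y ^ 3 * Real.cosh y / Real.sinh y ^ 3) (Set.Ioi 0) := by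
  have hd : ∀ y : ℝ, 0 < y → HasDerivAt (fun y : ℝ => y ^ 3 * Real.cosh y / Real.sinh y ^ 3)
      (y ^ 2 * (3 * Real.sinh y * Real.cosh y - 2 * y * Real.sinh y ^ 2 - 3 * y)
        / Real.sinh y ^ 4) y := fun y hy => by
    have hs := (Real.sinh_pos_iff.2 hy).ne'
    have := ((hasDerivAt_pow 3 y).mul (Real.hasDerivAt_cosh y)).div
      ((Real.hasDerivAt_sinh y).pow 3) (pow_ne_zero 3 hs)
    refine HasDerivAt.congr_deriv this ?_
    simp only [Pi.pow_apply, Pi.mul_apply]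
    rw [div_eq_div_iff (by positivity) (by positivity)]
    have := Real.cosh_sq y
    simp only [Nat.cast_ofNat, Nat.reduceSub]
    have e : 3 * y = 3 * y * (Real.cosh y ^ 2 - Real.sinh y ^ 2) := by rw [this]; ring
    rw [e]
    ring
  refine strictAntiOn_of_deriv_neg (convex_Ioi 0)
    (fun y hy => (hd y hy).continuousAt.continuousWithinAt) fun y hy => ?_
  rw [interior_Ioi] at hy
  rw [(hd y hy).deriv]
  have hs := Real.sinh_pos_iff.2 hy
  have hy0 : 0 < y := hy
  have h3 := three_mul_sinh_lt (x := 2 * y) (by linarith)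
  rw [Real.sinh_two_mul, Real.cosh_two_mul, Real.cosh_sq] at h3
  exact div_neg_of_neg_of_pos (mul_neg_of_pos_of_neg (by positivity) (by nlinarith))
    (by positivity)

/-! ### The scaled hyperbolic cotangent and its derivatives -/

theorem hasDerivAt_scaled_coth {c x : ℝ} (hc : 0 < c) (hx : 0 < x) :
    HasDerivAt (fun y => c * Real.cosh (c * y) / Real.sinh (c * y))
      (-(c / Real.sinh (c * x)) ^ 2) x := by
  have hs := (Real.sinh_pos_iff.2 (mul_pos hc hx)).ne'
  have hi : HasDerivAt (fun y : ℝ => c * y) c x := by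
    simpa using (hasDerivAt_id x).const_mul c
  have := ((hi.cosh).const_mul c).div hi.sinh hs
  refine HasDerivAt.congr_deriv this ?_
  have h2 := Real.cosh_sq (c * x)
  rw [div_pow, ← neg_div, div_left_inj' (by positivity)]
  linear_combination -(c ^ 2) * h2

theorem hasDerivAt_neg_sq_div_sinh {c x : ℝ} (hc : 0 < c) (hx : 0 < x) :
    HasDerivAt (fun y => -(c / Real.sinh (c * y)) ^ 2)
      (2 * (c ^ 3 * Real.cosh (c * x) / Real.sinh (c * x) ^ 3)) x := by
  have hs := (Real.sinh_pos_iff.2 (mul_pos hc hx)).ne'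
  have hi : HasDerivAt (fun y : ℝ => c * y) c x := by
    simpa using (hasDerivAt_id x).const_mul c
  have := (((hasDerivAt_const x c).div hi.sinh hs).pow 2).neg
  refine HasDerivAt.congr_deriv this ?_
  simp only [Pi.div_apply]
  push_cast
  field_simp
  ring

/-! ### The single-site generating function -/

/-- The generating function `∑ₖ exp (x (S - k))` of the weights of a single site. -/
def siteZ (d : ℕ) (x : ℝ) : ℝ := ∑ k : Fin (d + 1), Real.exp (x * weight d k)

theorem siteZ_pos (d : ℕ) (x : ℝ) : 0 < siteZ d x :=
  Finset.sum_pos (fun _ _ => Real.exp_pos _) Finset.univ_nonempty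

/-- The factor `sinh (x/2)` turns each exponential into a difference at neighbouring half-steps, so
the sum telescopes. The product form also holds at `x = 0`. -/
theorem sinh_mul_siteZ (d : ℕ) (x : ℝ) :
    Real.sinh (1 / 2 * x) * siteZ d x = Real.sinh ((2 * spin d + 1) / 2 * x) := by
  have h : ∀ k : ℕ, Real.sinh (1 / 2 * x) * Real.exp (x * (spin d - k))
      = Real.exp (x * (spin d + 1 / 2 - k)) / 2
        - Real.exp (x * (spin d + 1 / 2 - (k + 1 : ℕ))) / 2 := by
    intro k
    rw [Real.sinh_eq, div_mul_eq_mul_div, sub_mul, ← Real.exp_add, ← Real.exp_add, sub_div]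
    congr 3 <;> push_cast <;> ring_nf
  unfold siteZ weight
  rw [Finset.mul_sum, Fin.sum_univ_eq_sum_range
    (fun k : ℕ => Real.sinh (1 / 2 * x) * Real.exp (x * (spin d - k))) (d + 1),
    Finset.sum_congr rfl fun k _ => h k, Finset.sum_range_sub', Real.sinh_eq, sub_div]
  unfold spin
  congr 3 <;> push_cast <;> ring_nf

theorem eta_eq_log_siteZ (d : ℕ) (x : ℝ) : eta d x = Real.log (siteZ d x) := by
  unfold eta
  split_ifs with hx
  · subst hx
    simp [siteZ, spin]
    ring_nf
  · rw [← sinh_mul_siteZ, mul_div_cancel_left₀]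
    rw [Ne, Real.sinh_eq_zero]
    simpa using hx

theorem exp_eta (d : ℕ) (x : ℝ) : Real.exp (eta d x) = siteZ d x := by
  rw [eta_eq_log_siteZ, Real.exp_log (siteZ_pos d x)]

theorem eta_neg (d : ℕ) (x : ℝ) : eta d (-x) = eta d x := by
  unfold eta
  simp only [neg_eq_zero, mul_neg, Real.sinh_neg, neg_div_neg_eq]

theorem contDiff_eta (d : ℕ) : ContDiff ℝ 2 (eta d) := by
  rw [show eta d = fun x => Real.log (siteZ d x) from funext (eta_eq_log_siteZ d)]
  refine ContDiff.log ?_ fun x => (siteZ_pos d x).ne'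
  unfold siteZ
  fun_prop

theorem differentiable_eta (d : ℕ) : Differentiable ℝ (eta d) :=
  (contDiff_eta d).differentiable (by norm_num)

theorem contDiff_deriv_eta (d : ℕ) : ContDiff ℝ 1 (deriv (eta d)) :=
  ((contDiff_succ_iff_deriv (n := 1)).1 (by simpa [one_add_one_eq_two] using contDiff_eta d)).2.2

theorem differentiable_deriv_eta (d : ℕ) : Differentiable ℝ (deriv (eta d)) :=
  (contDiff_deriv_eta d).differentiable (by norm_num)

theorem continuous_deriv_eta (d : ℕ) : Continuous (deriv (eta d)) :=
  (differentiable_deriv_eta d).continuous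

theorem deriv_eta_neg (d : ℕ) (x : ℝ) : deriv (eta d) (-x) = -deriv (eta d) x := by
  have h := deriv_comp_neg (eta d) x
  rw [show (fun y => eta d (-y)) = eta d from funext (eta_neg d)] at h
  linarith

theorem deriv_eta_zero (d : ℕ) : deriv (eta d) 0 = 0 := by
  have := deriv_eta_neg d 0
  rw [neg_zero] at this
  linarith

theorem deriv_eta_of_pos (d : ℕ) {x : ℝ} (hx : 0 < x) :
    deriv (eta d) x
      = (2 * spin d + 1) / 2 * Real.cosh ((2 * spin d + 1) / 2 * x)
          / Real.sinh ((2 * spin d + 1) / 2 * x)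
        - 1 / 2 * Real.cosh (1 / 2 * x) / Real.sinh (1 / 2 * x) := by
  have hc : 0 < (2 * spin d + 1) / 2 := by unfold spin; positivity
  have hlog : ∀ c : ℝ, 0 < c → HasDerivAt (fun y => Real.log (Real.sinh (c * y)))
      (c * Real.cosh (c * x) / Real.sinh (c * x)) x := fun c hc => by
    have hi : HasDerivAt (fun y : ℝ => c * y) c x := by
      simpa using (hasDerivAt_id x).const_mul c
    have := hi.sinh.log (Real.sinh_pos_iff.2 (mul_pos hc hx)).ne'
    rwa [mul_comm (Real.cosh _)] at this
  refine HasDerivAt.deriv (((hlog _ hc).sub (hlog (1 / 2) (by norm_num))).congr_of_eventuallyEq ?_)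
  filter_upwards [lt_mem_nhds hx] with y hy
  rw [eta, if_neg hy.ne', Real.log_div]
  · rfl
  · exact (Real.sinh_pos_iff.2 (mul_pos hc hy)).ne'
  · exact (Real.sinh_pos_iff.2 (by positivity)).ne'

theorem deriv2_eta_of_pos (d : ℕ) {x : ℝ} (hx : 0 < x) :
    deriv (deriv (eta d)) x
      = -((2 * spin d + 1) / 2 / Real.sinh ((2 * spin d + 1) / 2 * x)) ^ 2
        - -(1 / 2 / Real.sinh (1 / 2 * x)) ^ 2 := by
  have hc : 0 < (2 * spin d + 1) / 2 := by unfold spin; positivity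
  refine HasDerivAt.deriv (((hasDerivAt_scaled_coth hc hx).sub
    (hasDerivAt_scaled_coth (c := 1 / 2) (by norm_num) hx)).congr_of_eventuallyEq ?_)
  filter_upwards [lt_mem_nhds hx] with y hy
  exact deriv_eta_of_pos d hy

theorem deriv3_eta_of_pos (d : ℕ) {x : ℝ} (hx : 0 < x) :
    deriv (deriv (deriv (eta d))) x
      = 2 * (((2 * spin d + 1) / 2) ^ 3 * Real.cosh ((2 * spin d + 1) / 2 * x)
          / Real.sinh ((2 * spin d + 1) / 2 * x) ^ 3)
        - 2 * ((1 / 2) ^ 3 * Real.cosh (1 / 2 * x) / Real.sinh (1 / 2 * x) ^ 3) := by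
  have hc : 0 < (2 * spin d + 1) / 2 := by unfold spin; positivity
  refine HasDerivAt.deriv (((hasDerivAt_neg_sq_div_sinh hc hx).sub
    (hasDerivAt_neg_sq_div_sinh (c := 1 / 2) (by norm_num) hx)).congr_of_eventuallyEq ?_)
  filter_upwards [lt_mem_nhds hx] with y hy
  exact deriv2_eta_of_pos d hy

theorem half_lt_of_one_le {d : ℕ} (hd : 1 ≤ d) : (1 / 2 : ℝ) < (2 * spin d + 1) / 2 := by
  have : (1 : ℝ) ≤ d := by exact_mod_cast hd
  unfold spin
  linarith

theorem spin_pos {d : ℕ} (hd : 1 ≤ d) : 0 < spin d := by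
  have := half_lt_of_one_le hd
  linarith

/-- Up to a factor `x²`, the two terms are values of `(y / sinh y)²` at `x/2` and at the larger
point `(2S+1)x/2`, and `y / sinh y` decreases. The sign of the third derivative comes from `y³ cosh
y / sinh³ y` in the same way. -/
theorem deriv2_eta_pos {d : ℕ} (hd : 1 ≤ d) {x : ℝ} (hx : 0 < x) :
    0 < deriv (deriv (eta d)) x := by
  rw [deriv2_eta_of_pos d hx]
  set c := (2 * spin d + 1) / 2
  have hlt : 1 / 2 < c := half_lt_of_one_le hd
  have hc : 0 < c := by linarith
  have h := strictAntiOn_div_sinh (a := 1 / 2 * x) (b := c * x) (by simpa using hx)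
    (mul_pos hc hx) (by nlinarith)
  have hs := Real.sinh_pos_iff.2 (mul_pos hc hx)
  have hs' := Real.sinh_pos_iff.2 (show (0 : ℝ) < 1 / 2 * x by positivity)
  have h' : c / Real.sinh (c * x) < 1 / 2 / Real.sinh (1 / 2 * x) := by
    refine lt_of_mul_lt_mul_right ?_ hx.le
    convert h using 1 <;> ring
  have h0 : 0 < c / Real.sinh (c * x) := by positivity
  nlinarith

theorem deriv3_eta_neg {d : ℕ} (hd : 1 ≤ d) {x : ℝ} (hx : 0 < x) :
    deriv (deriv (deriv (eta d))) x < 0 := by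
  rw [deriv3_eta_of_pos d hx]
  set c := (2 * spin d + 1) / 2
  have hlt : 1 / 2 < c := half_lt_of_one_le hd
  have hc : 0 < c := by linarith
  have h := strictAntiOn_cube_mul_cosh_div (a := 1 / 2 * x) (b := c * x) (by simpa using hx)
    (mul_pos hc hx) (by nlinarith)
  have h' : c ^ 3 * Real.cosh (c * x) / Real.sinh (c * x) ^ 3
      < (1 / 2) ^ 3 * Real.cosh (1 / 2 * x) / Real.sinh (1 / 2 * x) ^ 3 := by
    refine lt_of_mul_lt_mul_right ?_ (pow_nonneg hx.le 3)
    convert h using 1 <;> ring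
  linarith

theorem strictMono_deriv_eta {d : ℕ} (hd : 1 ≤ d) : StrictMono (deriv (eta d)) := by
  refine strictMono_of_odd_strictMonoOn_nonneg (deriv_eta_neg d) ?_
  refine strictMonoOn_of_deriv_pos (convex_Ici 0) (continuous_deriv_eta d).continuousOn
    fun x hx => ?_
  rw [interior_Ici] at hx
  exact deriv2_eta_pos hd hx

theorem strictConcaveOn_deriv_eta {d : ℕ} (hd : 1 ≤ d) :
    StrictConcaveOn ℝ (Set.Ici 0) (deriv (eta d)) := by
  refine strictConcaveOn_of_deriv2_neg (convex_Ici 0) (continuous_deriv_eta d).continuousOn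
    fun x hx => ?_
  rw [interior_Ici] at hx
  exact deriv3_eta_neg hd hx

theorem spin_mul_le_eta (d : ℕ) (x : ℝ) : spin d * x ≤ eta d x := by
  rw [eta_eq_log_siteZ, Real.le_log_iff_exp_le (siteZ_pos d x)]
  refine le_trans (le_of_eq ?_) (Finset.single_le_sum (fun k _ => (Real.exp_pos _).le)
    (Finset.mem_univ (0 : Fin (d + 1))))
  simp [weight, mul_comm]

theorem abs_weight_le (d : ℕ) (k : Fin (d + 1)) : |weight d k| ≤ spin d := by
  have h : ((k : ℕ) : ℝ) ≤ d := by exact_mod_cast Nat.lt_succ_iff.1 k.2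
  have h0 : (0 : ℝ) ≤ (k : ℕ) := Nat.cast_nonneg _
  unfold weight spin
  rw [abs_le]
  constructor <;> linarith

theorem hasDerivAt_siteZ (d : ℕ) (x : ℝ) :
    HasDerivAt (siteZ d) (∑ k : Fin (d + 1), weight d k * Real.exp (x * weight d k)) x := by
  unfold siteZ
  refine HasDerivAt.fun_sum fun k _ => ?_
  have := ((hasDerivAt_id x).mul_const (weight d k)).exp
  simpa [mul_comm] using this

theorem deriv_eta_le_spin (d : ℕ) (x : ℝ) : deriv (eta d) x ≤ spin d := by
  have h := ((hasDerivAt_siteZ d x).log (siteZ_pos d x).ne').deriv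
  rw [show (fun y => Real.log (siteZ d y)) = eta d from
    funext fun y => (eta_eq_log_siteZ d y).symm] at h
  rw [h, div_le_iff₀ (siteZ_pos d x), siteZ, Finset.mul_sum]
  exact Finset.sum_le_sum fun k _ => mul_le_mul_of_nonneg_right
    ((le_abs_self _).trans (abs_weight_le d k)) (Real.exp_pos _).le

theorem deriv_eta_lt_spin {d : ℕ} (hd : 1 ≤ d) (x : ℝ) : deriv (eta d) x < spin d :=
  (strictMono_deriv_eta hd (lt_add_one x)).trans_le (deriv_eta_le_spin d _)

theorem eta_sub_le {d : ℕ} (hd : 1 ≤ d) {x : ℝ} (hx : 0 < x) :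
    eta d x - eta d 0 ≤ deriv (eta d) x * x := by
  obtain ⟨c, hc, h⟩ := exists_deriv_eq_slope (eta d) hx
    (differentiable_eta d).continuous.continuousOn (differentiable_eta d).differentiableOn
  rw [sub_zero, eq_div_iff hx.ne'] at h
  rw [← h]
  exact mul_le_mul_of_nonneg_right (strictMono_deriv_eta hd hc.2).le hx.le

/-- Convexity gives `η(x) - η(0) ≤ x η'(x)`, and `η(x) ≥ S x`; together `η'(x) ≥ S - η(0)/x`. -/
theorem tendsto_deriv_eta_atTop {d : ℕ} (hd : 1 ≤ d) :
    Tendsto (deriv (eta d)) atTop (𝓝 (spin d)) := by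
  have h1 : Tendsto (fun x : ℝ => spin d - eta d 0 / x) atTop (𝓝 (spin d)) := by
    simpa using tendsto_const_nhds.sub (tendsto_const_nhds.div_atTop (a := eta d 0) tendsto_id)
  refine tendsto_of_tendsto_of_tendsto_of_le_of_le' h1 tendsto_const_nhds ?_
    (Eventually.of_forall fun x => deriv_eta_le_spin d x)
  filter_upwards [eventually_gt_atTop 0] with x hx
  have h2 := eta_sub_le hd hx
  have h3 := spin_mul_le_eta d x
  rw [sub_le_iff_le_add, ← sub_le_iff_le_add', le_div_iff₀ hx]
  linarith

theorem tendsto_eta_sub_atTop (d : ℕ) :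
    Tendsto (fun x => eta d x - spin d * x) atTop (𝓝 0) := by
  have h : ∀ x, eta d x - spin d * x = Real.log (∑ k : Fin (d + 1), Real.exp (-(k : ℕ) * x)) := by
    intro x
    have : siteZ d x = Real.exp (spin d * x) * ∑ k : Fin (d + 1), Real.exp (-(k : ℕ) * x) := by
      rw [siteZ, Finset.mul_sum]
      refine Finset.sum_congr rfl fun k _ => ?_
      rw [← Real.exp_add, weight]
      ring_nf
    rw [eta_eq_log_siteZ, this, Real.log_mul (Real.exp_pos _).ne', Real.log_exp]
    · ring
    · exact (Finset.sum_pos (fun _ _ => Real.exp_pos _) Finset.univ_nonempty).ne'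
  simp_rw [h]
  rw [← Real.log_one]
  refine (Real.continuousAt_log one_ne_zero).tendsto.comp ?_
  rw [show (1 : ℝ) = ∑ k : Fin (d + 1), if k = 0 then 1 else 0 by simp]
  refine tendsto_finsetSum _ fun k _ => ?_
  split_ifs with hk
  · simp [hk]
  · refine Real.tendsto_exp_atBot.comp ?_
    refine tendsto_id.const_mul_atTop_of_neg ?_
    have : (k : ℕ) ≠ 0 := fun h => hk (Fin.ext h)
    have : (0 : ℝ) < (k : ℕ) := by exact_mod_cast Nat.pos_of_ne_zero this
    linarith

theorem exists_deriv_eta_eq {d : ℕ} (hd : 1 ≤ d) {m : ℝ} (hm : m ∈ Set.Ico 0 (spin d)) :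
    ∃ x, 0 ≤ x ∧ deriv (eta d) x = m := by
  obtain ⟨X, hX, hX0⟩ := (((tendsto_deriv_eta_atTop hd).eventually
    (lt_mem_nhds hm.2)).and (eventually_ge_atTop 0)).exists
  obtain ⟨x, hx, h⟩ := intermediate_value_Icc hX0 (continuous_deriv_eta d).continuousOn
    (show m ∈ Set.Icc (deriv (eta d) 0) (deriv (eta d) X) from
      ⟨by rw [deriv_eta_zero]; exact hm.1, hX.le⟩)
  exact ⟨x, hx.1, h⟩

theorem xStar_deriv_eta {d : ℕ} (hd : 1 ≤ d) (x : ℝ) : xStar d (deriv (eta d) x) = x :=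
  (strictMono_deriv_eta hd).injective (Classical.epsilon_spec
    (p := fun y => deriv (eta d) y = deriv (eta d) x) ⟨x, rfl⟩)

theorem g_deriv_eta {d : ℕ} (hd : 1 ≤ d) (β x : ℝ) :
    g d β (deriv (eta d) x)
      = eta d x - deriv (eta d) x * x + β * deriv (eta d) x ^ 2 := by
  rw [g, if_pos (deriv_eta_lt_spin hd x), xStar_deriv_eta hd]

theorem deriv_eta_nonneg {d : ℕ} (hd : 1 ≤ d) {x : ℝ} (hx : 0 ≤ x) : 0 ≤ deriv (eta d) x := by
  have := (strictMono_deriv_eta hd).monotone hx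
  rwa [deriv_eta_zero] at this

theorem deriv_eta_pos {d : ℕ} (hd : 1 ≤ d) {x : ℝ} (hx : 0 < x) : 0 < deriv (eta d) x := by
  have := strictMono_deriv_eta hd hx
  rwa [deriv_eta_zero] at this

/-! ### Expansion of `η'` at the origin -/

theorem abs_exp_sub_taylor_le {x : ℝ} (hx : |x| ≤ 1) :
    |Real.exp x - (1 + x + x ^ 2 / 2 + x ^ 3 / 6 + x ^ 4 / 24 + x ^ 5 / 120)| ≤ |x| ^ 6 := by
  have h := Real.exp_bound hx (n := 6) (by norm_num)
  simp only [Finset.sum_range_succ, Finset.sum_range_zero, Nat.factorial] at h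
  norm_num at h
  refine h.trans ?_
  have : 0 ≤ |x| ^ 6 := by positivity
  linarith

theorem abs_cosh_sub_taylor_le {x : ℝ} (hx : |x| ≤ 1) :
    |Real.cosh x - (1 + x ^ 2 / 2 + x ^ 4 / 24)| ≤ |x| ^ 6 := by
  have h1 := abs_le.1 (abs_exp_sub_taylor_le hx)
  have h2 := abs_le.1 (abs_exp_sub_taylor_le (x := -x) (by rwa [abs_neg]))
  rw [abs_neg] at h2
  rw [Real.cosh_eq, abs_le]
  constructor <;> nlinarith [h1.1, h1.2, h2.1, h2.2]

theorem abs_sinh_sub_taylor_le {x : ℝ} (hx : |x| ≤ 1) :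
    |Real.sinh x - (x + x ^ 3 / 6 + x ^ 5 / 120)| ≤ |x| ^ 6 := by
  have h1 := abs_le.1 (abs_exp_sub_taylor_le hx)
  have h2 := abs_le.1 (abs_exp_sub_taylor_le (x := -x) (by rwa [abs_neg]))
  rw [abs_neg] at h2
  rw [Real.sinh_eq, abs_le]
  constructor <;> nlinarith [h1.1, h1.2, h2.1, h2.2]

theorem tendsto_coth_remainder :
    Tendsto (fun y : ℝ => (y * Real.cosh y / Real.sinh y - 1 - y ^ 2 / 3) / y ^ 4)
      (𝓝[>] 0) (𝓝 (-(1 / 45))) := by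
  have hs : ∀ y : ℝ, 0 < y → y < Real.sinh y := fun y hy => Real.self_lt_sinh_iff.2 hy
  have hb : ∀ y : ℝ, 0 < y → y < 1 →
      |(y * Real.cosh y / Real.sinh y - 1 - y ^ 2 / 3) / y ^ 4 - -(1 / 45)| ≤ 4 * y := by
    intro y hy hy1
    have hsy := hs y hy
    have hs0 : 0 < Real.sinh y := hy.trans hsy
    have hc := abs_le.1 (abs_cosh_sub_taylor_le (x := y) (by rw [abs_of_pos hy]; exact hy1.le))
    have hsh := abs_le.1 (abs_sinh_sub_taylor_le (x := y) (by rw [abs_of_pos hy]; exact hy1.le))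
    rw [abs_of_pos hy] at hc hsh
    set C := Real.cosh y - (1 + y ^ 2 / 2 + y ^ 4 / 24) with hC
    set s := Real.sinh y - (y + y ^ 3 / 6 + y ^ 5 / 120) with hsdef
    -- The Taylor polynomials cancel through order five. What is left are the Taylor errors `C` and
    -- `s` and terms of order seven and nine, in total at most `(1 + 2 + 1) y⁶`, over a denominator
    -- larger than `y⁵`.
    have e : (y * Real.cosh y / Real.sinh y - 1 - y ^ 2 / 3) / y ^ 4 - -(1 / 45)
        = (y * C - s * (1 + y ^ 2 / 3 - y ^ 4 / 45)
            + (y ^ 7 * (1 / 270 - 1 / 360) + y ^ 9 / 5400)) / (Real.sinh y * y ^ 4) := by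
      rw [hC, hsdef]
      field_simp
      ring
    rw [e, abs_div, abs_of_pos (by positivity : 0 < Real.sinh y * y ^ 4),
      div_le_iff₀ (by positivity)]
    have hy6 : 0 < y ^ 6 := by positivity
    have h7 : y ^ 7 ≤ y ^ 6 := pow_le_pow_of_le_one hy.le hy1.le (by norm_num)
    have h9 : y ^ 9 ≤ y ^ 6 := pow_le_pow_of_le_one hy.le hy1.le (by norm_num)
    have hy2 : y ^ 2 ≤ 1 := pow_le_one₀ hy.le hy1.le
    have hy4 : y ^ 4 ≤ 1 := pow_le_one₀ hy.le hy1.le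
    have hlow : 4 * y ^ 6 ≤ 4 * y * (Real.sinh y * y ^ 4) := by
      have : 0 < y ^ 5 := by positivity
      nlinarith
    refine le_trans ?_ hlow
    have hCa : |y * C| ≤ y ^ 6 := by
      rw [abs_mul, abs_of_pos hy]
      nlinarith [abs_le.2 hc, abs_nonneg C]
    have hsa : |s * (1 + y ^ 2 / 3 - y ^ 4 / 45)| ≤ y ^ 6 * 2 := by
      rw [abs_mul]
      refine mul_le_mul (abs_le.2 hsh) ?_ (abs_nonneg _) hy6.le
      rw [abs_le]
      constructor <;> nlinarith [sq_nonneg y, sq_nonneg (y ^ 2)]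
    have h7' : 0 < y ^ 7 := by positivity
    have h9' : 0 < y ^ 9 := by positivity
    have hra : |y ^ 7 * (1 / 270 - 1 / 360) + y ^ 9 / 5400| ≤ y ^ 6 := by
      rw [abs_le]
      constructor <;> linarith
    have := abs_add_le (y * C - s * (1 + y ^ 2 / 3 - y ^ 4 / 45))
      (y ^ 7 * (1 / 270 - 1 / 360) + y ^ 9 / 5400)
    have := abs_sub (y * C) (s * (1 + y ^ 2 / 3 - y ^ 4 / 45))
    linarith
  rw [tendsto_iff_norm_sub_tendsto_zero]
  have h0 : Tendsto (fun y : ℝ => 4 * y) (𝓝[>] 0) (𝓝 0) := by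
    have : Tendsto (fun y : ℝ => 4 * y) (𝓝 0) (𝓝 (4 * 0)) := tendsto_id.const_mul 4
    rw [mul_zero] at this
    exact this.mono_left nhdsWithin_le_nhds
  refine squeeze_zero' (Eventually.of_forall fun _ => norm_nonneg _) ?_ h0
  filter_upwards [Ioo_mem_nhdsGT (zero_lt_one' ℝ)] with y hy
  exact hb y hy.1 hy.2

/-- The third-order coefficient of `-η'` at the origin. -/
def cubicCoeff (d : ℕ) : ℝ := ((2 * spin d + 1) ^ 4 - 1) / 720

theorem cubicCoeff_pos {d : ℕ} (hd : 1 ≤ d) : 0 < cubicCoeff d := by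
  have := spin_pos hd
  have h : (1 : ℝ) < (2 * spin d + 1) ^ 4 := one_lt_pow₀ (by linarith) (by norm_num)
  exact div_pos (by linarith) (by norm_num)

theorem betaC_pos {d : ℕ} (hd : 1 ≤ d) : 0 < betaC d := by
  have := spin_pos hd
  unfold betaC
  positivity

/-- `η'` is the difference of `a coth (a x)` at `a = c = (2S+1)/2` and `a = 1/2`, so the poles
cancel. The linear coefficient is `(c² - 1/4)/3 = S(S+1)/3 = 1/(2β_c)`, which is the origin of
`β_c`. -/
theorem tendsto_cubic_remainder {d : ℕ} (hd : 1 ≤ d) :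
    Tendsto (fun x : ℝ => (1 / (2 * betaC d) * x - deriv (eta d) x) / x ^ 3)
      (𝓝[>] 0) (𝓝 (cubicCoeff d)) := by
  have hS := spin_pos hd
  set c := (2 * spin d + 1) / 2 with hc
  have hc0 : 0 < c := by positivity
  have hscale : ∀ a : ℝ, 0 < a → Tendsto (fun x : ℝ => a * x) (𝓝[>] 0) (𝓝[>] 0) := by
    intro a ha
    refine tendsto_nhdsWithin_iff.2 ⟨?_, ?_⟩
    · have : Tendsto (fun x : ℝ => a * x) (𝓝 0) (𝓝 (a * 0)) := tendsto_id.const_mul a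
      rw [mul_zero] at this
      exact this.mono_left nhdsWithin_le_nhds
    · filter_upwards [self_mem_nhdsWithin] with x hx using mul_pos ha hx
  have h1 := (tendsto_coth_remainder.comp (hscale c hc0)).const_mul (-c ^ 4)
  have h2 := (tendsto_coth_remainder.comp (hscale (1 / 2) (by norm_num))).const_mul ((1 / 2) ^ 4)
  have h := h1.add h2
  have e : -c ^ 4 * -(1 / 45) + (1 / 2) ^ 4 * -(1 / 45) = cubicCoeff d := by
    rw [cubicCoeff, hc]; ring
  rw [e] at h
  refine h.congr' ?_
  filter_upwards [self_mem_nhdsWithin] with x hx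
  have hx0 : 0 < x := hx
  have hs1 := (Real.sinh_pos_iff.2 (mul_pos hc0 hx0)).ne'
  have hs2 := (Real.sinh_pos_iff.2 (show (0 : ℝ) < 1 / 2 * x by positivity)).ne'
  rw [deriv_eta_of_pos d hx0, ← hc]
  have hb : 1 / (2 * betaC d) = (c ^ 2 - (1 / 2) ^ 2) / 3 := by
    rw [hc, betaC]; field_simp; ring
  rw [hb]
  simp only [Function.comp]
  set A := Real.cosh (c * x)
  set A' := Real.sinh (c * x)
  set D := Real.cosh (1 / 2 * x)
  set D' := Real.sinh (1 / 2 * x)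
  field_simp
  ring

theorem tendsto_deriv_eta_div {d : ℕ} (hd : 1 ≤ d) :
    Tendsto (fun x : ℝ => deriv (eta d) x / x) (𝓝[>] 0) (𝓝 (1 / (2 * betaC d))) := by
  have h2 : Tendsto (fun x : ℝ => x ^ 2) (𝓝[>] 0) (𝓝 0) := by
    have : Tendsto (fun x : ℝ => x ^ 2) (𝓝 0) (𝓝 (0 ^ 2)) := tendsto_id.pow 2
    rw [zero_pow two_ne_zero] at this
    exact this.mono_left nhdsWithin_le_nhds
  have h := (tendsto_const_nhds (x := 1 / (2 * betaC d))).sub ((tendsto_cubic_remainder hd).mul h2)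
  rw [mul_zero, sub_zero] at h
  refine h.congr' ?_
  filter_upwards [self_mem_nhdsWithin] with x hx
  have hx0 : x ≠ 0 := ne_of_gt hx
  field_simp
  ring

theorem hasDerivAt_deriv_eta_zero {d : ℕ} (hd : 1 ≤ d) :
    HasDerivAt (deriv (eta d)) (1 / (2 * betaC d)) 0 := by
  have h := (differentiable_deriv_eta d 0).hasDerivAt
  have h' := hasDerivAt_iff_tendsto_slope.1 h
  have h'' := h'.mono_left (nhdsWithin_mono 0 (fun x (hx : 0 < x) => hx.ne'))
  have : deriv (deriv (eta d)) 0 = 1 / (2 * betaC d) := by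
    refine tendsto_nhds_unique (l := 𝓝[>] 0) h'' ((tendsto_deriv_eta_div hd).congr fun x => ?_)
    simp [slope_def_field, deriv_eta_zero]
  rwa [this] at h

/-- By strict concavity the chord slope `η'(y)/y` decreases, and its limit at `0` is `1/(2β_c)`. -/
theorem deriv_eta_lt_linear {d : ℕ} (hd : 1 ≤ d) {x : ℝ} (hx : 0 < x) :
    deriv (eta d) x < 1 / (2 * betaC d) * x := by
  have hc := strictConcaveOn_deriv_eta hd
  have hanti : ∀ y, 0 < y → y < x → deriv (eta d) x / x < deriv (eta d) y / y := by
    intro y hy hyx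
    have := hc.slope_anti_adjacent (x := 0) (y := y) (z := x) (Set.self_mem_Ici) hx.le hy hyx
    rw [deriv_eta_zero, sub_zero, sub_zero, div_lt_div_iff₀ (by linarith) hy] at this
    rw [div_lt_div_iff₀ hx hy]
    nlinarith
  -- The limit only gives a weak inequality; taking it at `x/2` leaves room for a strict one at `x`.
  have h1 : deriv (eta d) (x / 2) / (x / 2) ≤ 1 / (2 * betaC d) := by
    refine ge_of_tendsto (tendsto_deriv_eta_div hd) ?_
    filter_upwards [Ioo_mem_nhdsGT (half_pos hx)] with y hy
    have := hc.slope_anti_adjacent (x := 0) (y := y) (z := x / 2) (Set.self_mem_Ici)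
      (half_pos hx).le hy.1 hy.2
    rw [deriv_eta_zero, sub_zero, sub_zero, div_lt_div_iff₀ (by linarith [hy.2]) hy.1] at this
    rw [div_le_div_iff₀ (half_pos hx) hy.1]
    nlinarith
  have h2 := (hanti (x / 2) (half_pos hx) (half_lt_self hx)).trans_le h1
  rwa [div_lt_iff₀ hx] at h2

/-! ### The mean-field equation -/

/-- The function `h + 2 β η'(x) - x`, whose largest zero is the mean field. -/
def meanFieldGap (d : ℕ) (β h x : ℝ) : ℝ := h + 2 * β * deriv (eta d) x - x

/-- The largest nonnegative solution of the mean-field equation `x = 2 β η'(x) + h`. -/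
def meanField (d : ℕ) (β h : ℝ) : ℝ := sSup {x | 0 ≤ x ∧ 0 ≤ meanFieldGap d β h x}

theorem continuous_meanFieldGap (d : ℕ) (β h : ℝ) : Continuous (meanFieldGap d β h) := by
  unfold meanFieldGap
  exact (continuous_const.add (continuous_const.mul (continuous_deriv_eta d))).sub continuous_id

theorem meanFieldGap_zero (d : ℕ) (β h : ℝ) : meanFieldGap d β h 0 = h := by
  simp [meanFieldGap, deriv_eta_zero]

theorem strictConcaveOn_meanFieldGap {d : ℕ} (hd : 1 ≤ d) {β : ℝ} (hβ : 0 < β) (h : ℝ) :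
    StrictConcaveOn ℝ (Set.Ici 0) (meanFieldGap d β h) := by
  refine ⟨convex_Ici 0, fun x hx y hy hxy a b ha hb hab => ?_⟩
  have := (strictConcaveOn_deriv_eta hd).2 hx hy hxy ha hb hab
  simp only [smul_eq_mul, meanFieldGap] at this ⊢
  have e : h = a * h + b * h := by rw [← add_mul, hab, one_mul]
  have := mul_lt_mul_of_pos_left this (show 0 < 2 * β by linarith)
  nlinarith

section MeanField

variable {d : ℕ} {β h : ℝ}

theorem meanField_aux (h0 : 0 ≤ h) (hβ : 0 < β) :
    (0 : ℝ) ∈ {x | 0 ≤ x ∧ 0 ≤ meanFieldGap d β h x} ∧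
      BddAbove {x | 0 ≤ x ∧ 0 ≤ meanFieldGap d β h x} := by
  refine ⟨⟨le_rfl, by rwa [meanFieldGap_zero]⟩, ⟨h + 2 * β * spin d, fun x hx => ?_⟩⟩
  have h1 := hx.2
  have h2 := mul_le_mul_of_nonneg_left (deriv_eta_le_spin d x) (show 0 ≤ 2 * β by linarith)
  unfold meanFieldGap at h1
  linarith

theorem meanField_nonneg (hβ : 0 < β) (h0 : 0 ≤ h) : 0 ≤ meanField d β h :=
  le_csSup (meanField_aux h0 hβ).2 (meanField_aux h0 hβ).1

theorem meanFieldGap_neg (hβ : 0 < β) (h0 : 0 ≤ h) {x : ℝ} (hx : meanField d β h < x) :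
    meanFieldGap d β h x < 0 := by
  by_contra! hc
  exact hx.not_ge (le_csSup (meanField_aux h0 hβ).2
    ⟨(meanField_nonneg hβ h0).trans hx.le, hc⟩)

theorem meanFieldGap_meanField (hβ : 0 < β) (h0 : 0 ≤ h) :
    meanFieldGap d β h (meanField d β h) = 0 := by
  have hcl : IsClosed {x | 0 ≤ x ∧ 0 ≤ meanFieldGap d β h x} :=
    (isClosed_le continuous_const continuous_id).inter
      (isClosed_le continuous_const (continuous_meanFieldGap d β h))
  refine le_antisymm ?_ (hcl.csSup_mem ⟨0, (meanField_aux h0 hβ).1⟩ (meanField_aux h0 hβ).2).2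
  refine le_of_tendsto (f := meanFieldGap d β h) (x := 𝓝[>] (meanField d β h))
    (((continuous_meanFieldGap d β h).tendsto _).mono_left nhdsWithin_le_nhds) ?_
  filter_upwards [self_mem_nhdsWithin] with x hx
  exact (meanFieldGap_neg hβ h0 hx).le

theorem meanField_eq (hβ : 0 < β) (h0 : 0 ≤ h) :
    meanField d β h = 2 * β * deriv (eta d) (meanField d β h) + h := by
  have := meanFieldGap_meanField (d := d) hβ h0
  unfold meanFieldGap at this
  linarith

/-- The gap is strictly concave and nonnegative at both ends: it equals `h` at `0` and `0` at the
mean field. With `meanFieldGap_neg` it thus changes sign at most once on `(0, ∞)`, and this makes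
the maximiser unique. -/
theorem meanFieldGap_pos (hd : 1 ≤ d) (hβ : 0 < β) (h0 : 0 ≤ h) {x : ℝ} (hx0 : 0 < x)
    (hx : x < meanField d β h) : 0 < meanFieldGap d β h x := by
  have h1 := (strictConcaveOn_meanFieldGap hd hβ h).lt_on_openSegment (Set.self_mem_Ici)
    (hx0.trans hx).le (hx0.trans hx).ne
    (by rw [openSegment_eq_Ioo (hx0.trans hx)]; exact ⟨hx0, hx⟩)
  rw [meanFieldGap_zero, meanFieldGap_meanField hβ h0, min_eq_right h0] at h1
  exact h1

theorem lt_meanField (hβ : 0 < β) (h0 : 0 ≤ h) {x : ℝ}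
    (hx : 0 < meanFieldGap d β h x) (hx0 : 0 ≤ x) : x < meanField d β h := by
  refine lt_of_le_of_ne (le_csSup (meanField_aux h0 hβ).2 ⟨hx0, hx.le⟩) fun he => ?_
  rw [he, meanFieldGap_meanField hβ h0] at hx
  exact lt_irrefl _ hx

theorem meanField_pos (hβ : 0 < β) (h0 : 0 < h) : 0 < meanField d β h :=
  lt_meanField hβ h0.le (by rwa [meanFieldGap_zero]) le_rfl

theorem meanField_pos_of_betaC_lt (hd : 1 ≤ d) (hβ : betaC d < β) : 0 < meanField d β 0 := by
  have hb := betaC_pos hd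
  have hβ0 := hb.trans hβ
  have h1 : 1 / (2 * β) < 1 / (2 * betaC d) :=
    one_div_lt_one_div_of_lt (by linarith) (by linarith)
  obtain ⟨x, hx, hx0⟩ := (((tendsto_deriv_eta_div hd).eventually (lt_mem_nhds h1)).and
    self_mem_nhdsWithin).exists
  have hx0 : 0 < x := hx0
  refine hx0.trans (lt_meanField hβ0 le_rfl ?_ hx0.le)
  rw [div_lt_div_iff₀ (by linarith) hx0] at hx
  unfold meanFieldGap
  linarith

theorem meanField_eq_zero (hd : 1 ≤ d) (hβ : 0 < β) (hc : β ≤ betaC d) :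
    meanField d β 0 = 0 := by
  have hb := betaC_pos hd
  refine le_antisymm ?_ (meanField_nonneg hβ le_rfl)
  by_contra! hpos
  have h1 := deriv_eta_lt_linear hd hpos
  have h2 := meanField_eq (d := d) hβ le_rfl
  set x := meanField d β 0
  have h3 := mul_lt_mul_of_pos_left h1 (show 0 < 2 * β by linarith)
  have h4 : 2 * β * (1 / (2 * betaC d) * x) ≤ x := by
    rw [show 2 * β * (1 / (2 * betaC d) * x) = β / betaC d * x by field_simp]
    exact mul_le_of_le_one_left hpos.le ((div_le_one hb).2 hc)
  linarith

/-- The mean field depends continuously on the parameters. -/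
theorem tendsto_meanField {α : Type*} {l : Filter α} {b k : α → ℝ} (hd : 1 ≤ d)
    (hβ : 0 < β) (h0 : 0 ≤ h) (hb : Tendsto b l (𝓝 β)) (hk : Tendsto k l (𝓝 h))
    (hk0 : ∀ᶠ a in l, 0 ≤ k a) :
    Tendsto (fun a => meanField d (b a) (k a)) l (𝓝 (meanField d β h)) := by
  have hb0 : ∀ᶠ a in l, 0 < b a := hb.eventually (lt_mem_nhds hβ)
  have hgap : ∀ x, Tendsto (fun a => meanFieldGap d (b a) (k a) x) l (𝓝 (meanFieldGap d β h x)) :=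
    fun x => by
      unfold meanFieldGap
      exact (hk.add ((hb.const_mul 2).mul_const _)).sub_const x
  refine tendsto_order.2 ⟨fun x hx => ?_, fun x hx => ?_⟩
  · rcases lt_or_ge x 0 with hx0 | hx0
    · filter_upwards [hb0, hk0] with a ha hka
      exact hx0.trans_le (meanField_nonneg ha hka)
    · obtain ⟨y, hxy, hy⟩ := exists_between hx
      have hy0 := hx0.trans_lt hxy
      filter_upwards [hb0, hk0, (hgap y).eventually
        (lt_mem_nhds (meanFieldGap_pos hd hβ h0 hy0 hy))] with a ha hka hg
      exact hxy.trans (lt_meanField ha hka hg hy0.le)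
  · filter_upwards [hb0, hk0, (hgap x).eventually
      (gt_mem_nhds (meanFieldGap_neg hβ h0 hx))] with a ha hka hg
    by_contra! hc
    rcases hc.lt_or_eq with hc | hc
    · exact hg.not_ge (meanFieldGap_pos hd ha hka
        ((meanField_nonneg hβ h0).trans_lt hx) hc).le
    · rw [hc, meanFieldGap_meanField ha hka] at hg
      exact lt_irrefl _ hg

/-! ### The variational problem -/

/-- The objective in the variable `x`, where `m = η'(x)`: the two `η'` terms cancel and a factor
`η''` comes out, so no derivative of `x⋆` is needed. -/
theorem hasDerivAt_freeEnergy (d : ℕ) (β h x : ℝ) :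
    HasDerivAt (fun y => eta d y - deriv (eta d) y * y + β * deriv (eta d) y ^ 2
      + h * deriv (eta d) y) (deriv (deriv (eta d)) x * meanFieldGap d β h x) x := by
  have h1 := (differentiable_eta d x).hasDerivAt
  have h2 := (differentiable_deriv_eta d x).hasDerivAt
  refine (((h1.sub (h2.mul (hasDerivAt_id x))).add ((h2.pow 2).const_mul β)).add
    (h2.const_mul h)).congr_deriv ?_
  simp [meanFieldGap]
  ring

/-- The maximum of `g_β(m) + |h| m` over `[0, S]`. -/
def freeEnergy (d : ℕ) (β h : ℝ) : ℝ :=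
  g d β (deriv (eta d) (meanField d β |h|)) + |h| * deriv (eta d) (meanField d β |h|)

theorem g_add_lt (hd : 1 ≤ d) (hβ : 0 < β) (h0 : 0 ≤ h) {m : ℝ} (hm : m ∈ Set.Icc 0 (spin d))
    (hne : m ≠ deriv (eta d) (meanField d β h)) :
    g d β m + h * m
      < g d β (deriv (eta d) (meanField d β h)) + h * deriv (eta d) (meanField d β h) := by
  set G : ℝ → ℝ := fun y => eta d y - deriv (eta d) y * y + β * deriv (eta d) y ^ 2
      + h * deriv (eta d) y with hG
  set x₀ := meanField d β h with hx₀
  have hx0 : 0 ≤ x₀ := meanField_nonneg hβ h0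
  have hcont : Continuous G :=
    continuous_iff_continuousAt.2 fun x => (hasDerivAt_freeEnergy d β h x).continuousAt
  have hinc : StrictMonoOn G (Set.Icc 0 x₀) := by
    refine strictMonoOn_of_deriv_pos (convex_Icc 0 x₀) hcont.continuousOn fun x hx => ?_
    rw [interior_Icc] at hx
    rw [(hasDerivAt_freeEnergy d β h x).deriv]
    exact mul_pos (deriv2_eta_pos hd hx.1) (meanFieldGap_pos hd hβ h0 hx.1 hx.2)
  have hdec : StrictAntiOn G (Set.Ici x₀) := by
    refine strictAntiOn_of_deriv_neg (convex_Ici x₀) hcont.continuousOn fun x hx => ?_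
    rw [interior_Ici] at hx
    rw [(hasDerivAt_freeEnergy d β h x).deriv]
    exact mul_neg_of_pos_of_neg (deriv2_eta_pos hd (hx0.trans_lt hx)) (meanFieldGap_neg hβ h0 hx)
  rw [g_deriv_eta hd]
  change _ < G x₀
  rcases hm.2.lt_or_eq with hlt | heq
  · obtain ⟨x, hx, rfl⟩ := exists_deriv_eta_eq hd ⟨hm.1, hlt⟩
    rw [g_deriv_eta hd]
    change G x < _
    rcases lt_trichotomy x x₀ with h1 | h1 | h1
    · exact hinc ⟨hx, h1.le⟩ ⟨hx0, le_rfl⟩ h1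
    · exact absurd (by rw [h1]) hne
    · exact hdec Set.self_mem_Ici h1.le h1
  -- The endpoint `m = S` corresponds to `x → ∞`. Because `η(x) - x η'(x) ≥ 0`, its value is at most
  -- the limit of `G`, hence at most `G (x₀ + 1) < G x₀`.
  · have hlim : Tendsto (fun x => β * deriv (eta d) x ^ 2 + h * deriv (eta d) x) atTop
        (𝓝 (β * m ^ 2 + h * m)) := by
      rw [heq]
      exact (((tendsto_deriv_eta_atTop hd).pow 2).const_mul β).add
        ((tendsto_deriv_eta_atTop hd).const_mul h)
    rw [g, if_neg heq.not_lt]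
    refine lt_of_le_of_lt (le_of_tendsto hlim ?_)
      (hdec Set.self_mem_Ici (lt_add_one x₀).le (lt_add_one x₀))
    filter_upwards [eventually_ge_atTop (x₀ + 1)] with x hx
    refine le_trans ?_ (hdec.antitoneOn (lt_add_one x₀).le
      ((lt_add_one x₀).le.trans hx) hx)
    have h1 := spin_mul_le_eta d x
    have h2 := mul_le_mul_of_nonneg_right (deriv_eta_le_spin d x) (show 0 ≤ x by linarith)
    simp only [hG]
    linarith

theorem deriv_eta_meanField_mem (hd : 1 ≤ d) (hβ : 0 < β) (h0 : 0 ≤ h) :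
    deriv (eta d) (meanField d β h) ∈ Set.Ico 0 (spin d) :=
  ⟨deriv_eta_nonneg hd (meanField_nonneg hβ h0), deriv_eta_lt_spin hd _⟩

theorem g_add_le_freeEnergy (hd : 1 ≤ d) (hβ : 0 < β) (h : ℝ) {m : ℝ}
    (hm : m ∈ Set.Icc 0 (spin d)) : g d β m + |h| * m ≤ freeEnergy d β h := by
  by_cases hne : m = deriv (eta d) (meanField d β |h|)
  · rw [hne, freeEnergy]
  · exact (g_add_lt hd hβ (abs_nonneg h) hm hne).le

theorem isGreatest_freeEnergy (hd : 1 ≤ d) (hβ : 0 < β) (h : ℝ) :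
    IsGreatest ((fun m => g d β m + |h| * m) '' Set.Icc 0 (spin d)) (freeEnergy d β h) := by
  have hmem := deriv_eta_meanField_mem hd hβ (abs_nonneg h)
  refine ⟨⟨_, ⟨hmem.1, hmem.2.le⟩, rfl⟩, ?_⟩
  rintro _ ⟨m, hm, rfl⟩
  exact g_add_le_freeEnergy hd hβ h hm

theorem isMaximiser_iff (hd : 1 ≤ d) (hβ : 0 < β) (m : ℝ) :
    IsMaximiser d β m ↔ m = deriv (eta d) (meanField d β 0) := by
  have hmem := deriv_eta_meanField_mem (d := d) hd hβ le_rfl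
  constructor
  · rintro ⟨hm, hmax⟩
    by_contra hne
    have h1 := g_add_lt hd hβ le_rfl ⟨hm.1, hm.2.le⟩ hne
    have h2 := hmax ⟨hmem.1, hmem.2.le⟩
    simp only [Set.mem_ofPred_eq] at h2
    linarith
  · rintro rfl
    refine ⟨hmem, fun m hm => ?_⟩
    have h1 := g_add_le_freeEnergy hd hβ 0 hm
    simpa [freeEnergy] using h1

theorem mStar_eq (hd : 1 ≤ d) (hβ : 0 < β) : mStar d β = deriv (eta d) (meanField d β 0) :=
  (isMaximiser_iff hd hβ _).1 (Classical.epsilon_spec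
    (p := fun m => IsMaximiser d β m) ⟨_, (isMaximiser_iff hd hβ _).2 rfl⟩)

end MeanField

/-! ### The magnetization -/

/-- The solution of the mean-field equation with the sign of `h`. -/
def signedField (d : ℕ) (β h : ℝ) : ℝ := SignType.sign h * meanField d β |h|

theorem deriv_eta_signedField (d : ℕ) (β h : ℝ) :
    deriv (eta d) (signedField d β h) = SignType.sign h * deriv (eta d) (meanField d β |h|) := by
  unfold signedField
  rcases lt_trichotomy h 0 with hh | rfl | hh
  · simp [hh, deriv_eta_neg]
  · simp [deriv_eta_zero]
  · simp [hh]

/-- The subgradient inequalities at `a` and at `x` trap the first-order error between `0` and `(φ x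
- φ a)(x - a)`. -/
theorem hasDerivAt_of_subgradient {f φ : ℝ → ℝ} {a : ℝ}
    (hf : ∀ x y, f y + (x - y) * φ y ≤ f x) (hφ : ContinuousAt φ a) : HasDerivAt f (φ a) a := by
  rw [hasDerivAt_iff_isLittleO]
  refine Asymptotics.IsLittleO.of_bound fun ε hε => ?_
  have hev : ∀ᶠ x in 𝓝 a, |φ x - φ a| < ε := by
    simpa [Real.dist_eq] using Metric.tendsto_nhds.1 hφ ε hε
  filter_upwards [hev] with x hx
  have h1 := hf x a
  have h2 := hf a x
  rw [Real.norm_eq_abs, Real.norm_eq_abs, smul_eq_mul, abs_of_nonneg (by linarith)]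
  calc f x - f a - (x - a) * φ a ≤ (φ x - φ a) * (x - a) := by linarith
    _ ≤ |(φ x - φ a) * (x - a)| := le_abs_self _
    _ ≤ ε * |x - a| := by
      rw [abs_mul]
      exact mul_le_mul_of_nonneg_right hx.le (abs_nonneg _)

section Magnetization

variable {d : ℕ} {β : ℝ}

/-- The maximiser at field `y` is a competitor at field `x`, and `x sign y ≤ |x|`. -/
theorem freeEnergy_subgradient (hd : 1 ≤ d) (hβ : 0 < β) (x y : ℝ) :
    freeEnergy d β y + (x - y) * deriv (eta d) (signedField d β y) ≤ freeEnergy d β x := by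
  have hmem := deriv_eta_meanField_mem hd hβ (abs_nonneg y)
  have h1 := g_add_le_freeEnergy hd hβ x ⟨hmem.1, hmem.2.le⟩
  refine le_trans ?_ h1
  rw [deriv_eta_signedField, freeEnergy]
  set m := deriv (eta d) (meanField d β |y|)
  have hm : 0 ≤ m := hmem.1
  have e : y * SignType.sign y = |y| := self_mul_sign y
  have hx : x * SignType.sign y ≤ |x| := by
    rcases lt_trichotomy y 0 with hy | rfl | hy
    · simpa [hy] using neg_le_abs x
    · simp
    · simpa [hy] using le_abs_self x
  have h2 := mul_le_mul_of_nonneg_right hx hm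
  have e2 : (x - y) * (SignType.sign y * m) = x * SignType.sign y * m - |y| * m := by
    rw [← e]; ring
  rw [e2]
  linarith

theorem tendsto_meanField_abs (hd : 1 ≤ d) (hβ : 0 < β) (a : ℝ) :
    Tendsto (fun h => meanField d β |h|) (𝓝 a) (𝓝 (meanField d β |a|)) :=
  tendsto_meanField hd hβ (abs_nonneg a) tendsto_const_nhds
    (continuous_abs.tendsto a) (Eventually.of_forall abs_nonneg)

/-- At `a = 0` the sign jumps, which does no harm because the mean field at zero field vanishes when
`β ≤ β_c`. -/
theorem continuousAt_signedField (hd : 1 ≤ d) (hβ : 0 < β) {a : ℝ}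
    (ha : a ≠ 0 ∨ β ≤ betaC d) : ContinuousAt (signedField d β) a := by
  have ht := tendsto_meanField_abs hd hβ a
  rcases lt_trichotomy a 0 with h | rfl | h
  · refine ht.neg.congr' ?_ |>.trans (le_of_eq ?_)
    · filter_upwards [gt_mem_nhds h] with x hx
      simp [signedField, hx]
    · simp [signedField, h]
  · have hc : β ≤ betaC d := ha.resolve_left (by simp)
    rw [abs_zero, meanField_eq_zero hd hβ hc] at ht
    have : signedField d β 0 = 0 := by simp [signedField]
    rw [ContinuousAt, this]
    refine squeeze_zero_norm (fun x => ?_) ht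
    rw [signedField, norm_mul]
    have h0 : 0 ≤ meanField d β |x| := meanField_nonneg hβ (abs_nonneg x)
    rw [Real.norm_of_nonneg h0]
    refine mul_le_of_le_one_left h0 ?_
    rcases lt_trichotomy x 0 with h | rfl | h
    · simp [h]
    · simp
    · simp [h]
  · refine ht.congr' ?_ |>.trans (le_of_eq ?_)
    · filter_upwards [lt_mem_nhds h] with x hx
      simp [signedField, hx]
    · simp [signedField, h]

theorem hasDerivAt_freeEnergy_field (hd : 1 ≤ d) (hβ : 0 < β) {a : ℝ}
    (ha : a ≠ 0 ∨ β ≤ betaC d) :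
    HasDerivAt (freeEnergy d β) (deriv (eta d) (signedField d β a)) a :=
  hasDerivAt_of_subgradient (φ := fun y => deriv (eta d) (signedField d β y))
    (freeEnergy_subgradient hd hβ)
    ((continuous_deriv_eta d).continuousAt.comp (continuousAt_signedField hd hβ ha))

/-- The signed field is a right inverse of `x ↦ x - 2βη'(x)`, whose slope at `0` is `1 - β/β_c ≠ 0`.
The chain rule gives `(1/(2β_c)) · β_c/(β_c - β)`. -/
theorem hasDerivAt_deriv_eta_signedField (hd : 1 ≤ d) (hβ : 0 < β) (hc : β < betaC d) :
    HasDerivAt (fun h => deriv (eta d) (signedField d β h)) (1 / 2 * (betaC d - β)⁻¹) 0 := by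
  have hb := betaC_pos hd
  have h0 : signedField d β 0 = 0 := by simp [signedField]
  have hR : HasDerivAt (fun x => x - 2 * β * deriv (eta d) x)
      (1 - 2 * β * (1 / (2 * betaC d))) (signedField d β 0) := by
    rw [h0]
    exact (hasDerivAt_id (0 : ℝ)).sub ((hasDerivAt_deriv_eta_zero hd).const_mul (2 * β))
  have hne : 1 - 2 * β * (1 / (2 * betaC d)) ≠ 0 := by
    have : 1 - 2 * β * (1 / (2 * betaC d)) = (betaC d - β) / betaC d := by field_simp
    rw [this]
    exact (div_pos (by linarith) hb).ne'
  have hX := hR.of_local_left_inverse (continuousAt_signedField hd hβ (Or.inr hc.le)) hne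
    (Eventually.of_forall fun y => by
      rw [deriv_eta_signedField, signedField]
      have := meanField_eq (d := d) hβ (abs_nonneg y)
      have e := self_mul_sign y
      rcases lt_trichotomy y 0 with h | rfl | h
      · simp only [h, sign_neg, SignType.coe_neg_one, mul_neg, mul_one] at e ⊢
        linarith
      · simp
      · simp only [h, sign_pos, SignType.coe_one, mul_one] at e ⊢
        linarith)
  have hm := hasDerivAt_deriv_eta_zero hd
  rw [← h0] at hm
  refine (hm.comp (0 : ℝ) hX).congr_deriv ?_
  have : betaC d - β ≠ 0 := by linarith
  have e : 1 - 2 * β * (1 / (2 * betaC d)) = (betaC d - β) / betaC d := by field_simp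
  rw [e]
  field_simp

/-! ### Critical behaviour of the mean field -/

theorem tendsto_nhdsGT_zero_of_pos {α : Type*} {l : Filter α} {f : α → ℝ}
    (hf : Tendsto f l (𝓝 0)) (hpos : ∀ᶠ a in l, 0 < f a) : Tendsto f l (𝓝[>] 0) :=
  tendsto_nhdsWithin_iff.2 ⟨hf, hpos⟩

theorem tendsto_mStar_div (hd : 1 ≤ d) :
    Tendsto (fun β => mStar d β / (β - betaC d) ^ (1 / 2 : ℝ)) (𝓝[>] (betaC d))
      (𝓝 (1 / (2 * betaC d) * (1 / (2 * betaC d ^ 2) / cubicCoeff d) ^ (1 / 2 : ℝ))) := by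
  have hb := betaC_pos hd
  have hcub := cubicCoeff_pos hd
  have hid : Tendsto (fun β : ℝ => β) (𝓝[>] (betaC d)) (𝓝 (betaC d)) := nhdsWithin_le_nhds
  have hX0 : Tendsto (fun β => meanField d β 0) (𝓝[>] (betaC d)) (𝓝[>] 0) := by
    refine tendsto_nhdsGT_zero_of_pos ?_ ?_
    · have := tendsto_meanField hd hb (le_refl (0 : ℝ)) hid
        (tendsto_const_nhds (x := (0 : ℝ))) (Eventually.of_forall fun _ => le_rfl)
      rwa [meanField_eq_zero hd hb le_rfl] at this
    · filter_upwards [self_mem_nhdsWithin] with β hβ using meanField_pos_of_betaC_lt hd hβ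
  have h1 := (tendsto_cubic_remainder hd).comp hX0
  have h2 := (tendsto_deriv_eta_div hd).comp hX0
  have h3 : Tendsto (fun β : ℝ => 1 / (2 * (betaC d * β))) (𝓝[>] (betaC d))
      (𝓝 (1 / (2 * betaC d ^ 2))) := by
    rw [sq]
    exact tendsto_const_nhds.div ((hid.const_mul _).const_mul 2) (by positivity)
  have h4 := h2.mul ((h3.div h1 hcub.ne').rpow_const (p := 1 / 2) (Or.inr (by norm_num)))
  refine h4.congr' ?_
  filter_upwards [self_mem_nhdsWithin] with β hβ
  have hβ' : betaC d < β := hβ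
  have hβ0 : 0 < β := hb.trans hβ'
  have hx := meanField_pos_of_betaC_lt hd hβ'
  have he := meanField_eq (d := d) hβ0 (le_refl (0 : ℝ))
  rw [mStar_eq hd hβ0]
  simp only [Function.comp, Pi.div_apply]
  set x := meanField d β 0
  set B := deriv (eta d) x
  have hB : B = x / (2 * β) := by rw [eq_div_iff (by positivity)]; linarith
  have hsub : 0 < β - betaC d := by linarith
  -- The mean-field equation gives `B = x/(2β)`, so the cubic remainder equals `x(β - β_c)/(2β_cβ)`;
  -- its quotient by `x³` has a positive limit, which fixes the limit of `x²/(β - β_c)`.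
  have e1 : 1 / (2 * (betaC d * β)) / ((1 / (2 * betaC d) * x - B) / x ^ 3)
      = x ^ 2 / (β - betaC d) := by
    have : 1 / (2 * betaC d) * x - B = x * (β - betaC d) / (2 * (betaC d * β)) := by
      rw [hB]; field_simp
    rw [this]
    field_simp
  rw [e1, Real.div_rpow (by positivity) hsub.le, ← Real.sqrt_eq_rpow (x ^ 2),
    Real.sqrt_sq hx.le]
  field_simp

theorem tendsto_meanField_div (hd : 1 ≤ d) :
    Tendsto (fun h => deriv (eta d) (meanField d (betaC d) h) / h ^ (1 / 3 : ℝ)) (𝓝[>] 0)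
      (𝓝 (1 / (2 * betaC d) * (1 / (2 * betaC d * cubicCoeff d)) ^ (1 / 3 : ℝ))) := by
  have hb := betaC_pos hd
  have hcub := cubicCoeff_pos hd
  have hX0 : Tendsto (fun h => meanField d (betaC d) h) (𝓝[>] 0) (𝓝[>] 0) := by
    refine tendsto_nhdsGT_zero_of_pos ?_ ?_
    · have := tendsto_meanField hd hb (le_refl (0 : ℝ)) (l := 𝓝[>] (0 : ℝ))
        (tendsto_const_nhds (x := betaC d)) (k := fun h => h) nhdsWithin_le_nhds
        (by filter_upwards [self_mem_nhdsWithin] with x hx using le_of_lt hx)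
      rwa [meanField_eq_zero hd hb le_rfl] at this
    · filter_upwards [self_mem_nhdsWithin] with h hh using meanField_pos hb hh
  have h1 := ((tendsto_cubic_remainder hd).comp hX0).const_mul (2 * betaC d)
  have h2 := (tendsto_deriv_eta_div hd).comp hX0
  have h4 := h2.mul (((tendsto_const_nhds (x := (1 : ℝ))).div h1
    (by positivity)).rpow_const (p := 1 / 3) (Or.inr (by norm_num)))
  refine h4.congr' ?_
  filter_upwards [self_mem_nhdsWithin] with h hh
  have hh0 : 0 < h := hh
  have hx := meanField_pos (d := d) hb hh0
  have he := meanField_eq (d := d) hb hh0.le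
  simp only [Function.comp, Pi.div_apply]
  set x := meanField d (betaC d) h
  set B := deriv (eta d) x
  -- At `β = β_c` the linear terms of the mean-field equation cancel, and `h` is exactly `2β_c`
  -- times the cubic remainder.
  have e1 : 1 / (2 * betaC d * ((1 / (2 * betaC d) * x - B) / x ^ 3)) = x ^ 3 / h := by
    have : 2 * betaC d * ((1 / (2 * betaC d) * x - B) / x ^ 3) = h / x ^ 3 := by
      have : h = x - 2 * betaC d * B := by linarith
      rw [this]
      field_simp
    rw [this, one_div_div]
  have e2 : (x ^ 3) ^ (1 / 3 : ℝ) = x := by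
    rw [← Real.rpow_natCast, ← Real.rpow_mul hx.le]
    norm_num
  rw [e1, Real.div_rpow (by positivity) hh0.le, e2]
  have : 0 < h ^ (1 / 3 : ℝ) := Real.rpow_pos_of_pos hh0 _
  field_simp

end Magnetization

section

open Matrix

/-! ### Single-site spin matrices -/

theorem raise_coeff_eq (d : ℕ) (k : Fin (d + 1)) :
    spin d * (spin d + 1) - weight d k * (weight d k + 1)
      = ((k : ℕ) : ℝ) * ((d : ℝ) + 1 - (k : ℕ)) := by
  unfold weight spin
  ring

theorem raise_coeff_nonneg (d : ℕ) (k : Fin (d + 1)) :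
    0 ≤ spin d * (spin d + 1) - weight d k * (weight d k + 1) := by
  rw [raise_coeff_eq]
  have h : ((k : ℕ) : ℝ) ≤ d := by exact_mod_cast Nat.lt_succ_iff.1 k.2
  exact mul_nonneg (Nat.cast_nonneg _) (by linarith)

theorem ofReal_sqrt_mul_self {x : ℝ} (hx : 0 ≤ x) :
    ((Real.sqrt x : ℝ) : ℂ) * ((Real.sqrt x : ℝ) : ℂ) = (x : ℂ) := by
  rw [← Complex.ofReal_mul, Real.mul_self_sqrt hx]

theorem spinLower_mul_spinRaise (d : ℕ) :
    (spinRaise d)ᴴ * spinRaise d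
      = Matrix.diagonal fun k =>
        ((spin d * (spin d + 1) - weight d k * (weight d k + 1) : ℝ) : ℂ) := by
  ext k l
  rw [mul_apply]
  simp only [spinRaise, conjTranspose_apply, of_apply, apply_ite star, star_zero,
    Complex.star_def, Complex.conj_ofReal]
  by_cases hkl : k = l
  · subst hkl
    rw [diagonal_apply_eq]
    induction k using Fin.cases with
    | zero => simp [weight]
    | succ k =>
      have : ∀ j : Fin (d + 1), ((j : ℕ) + 1 = (k.succ : ℕ)) ↔ j = k.castSucc := by
        intro j
        rw [Fin.ext_iff]
        simp
      simp only [this]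
      rw [Finset.sum_congr rfl (g := fun j => if j = k.castSucc then
        ((spin d * (spin d + 1) - weight d k.succ * (weight d k.succ + 1) : ℝ) : ℂ) else 0)
        (fun j _ => by
          split_ifs
          · exact ofReal_sqrt_mul_self (raise_coeff_nonneg d _)
          · simp)]
      rw [Finset.sum_ite_eq', if_pos (Finset.mem_univ _)]
  · rw [diagonal_apply_ne _ hkl]
    refine Finset.sum_eq_zero fun j _ => ?_
    split_ifs with h1 h2
    · exact absurd (Fin.ext (h1.symm.trans h2)) hkl
    all_goals simp

theorem spinRaise_mul_spinLower (d : ℕ) :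
    spinRaise d * (spinRaise d)ᴴ
      = Matrix.diagonal fun k =>
        ((spin d * (spin d + 1) - weight d k * (weight d k - 1) : ℝ) : ℂ) := by
  ext k l
  rw [mul_apply]
  simp only [spinRaise, conjTranspose_apply, of_apply, apply_ite star, star_zero,
    Complex.star_def, Complex.conj_ofReal]
  by_cases hkl : k = l
  · subst hkl
    rw [diagonal_apply_eq]
    induction k using Fin.lastCases with
    | last =>
      rw [Finset.sum_eq_zero]
      · rw [eq_comm, Complex.ofReal_eq_zero]
        simp only [weight, spin, Fin.val_last]
        ring
      · intro j _
        rw [if_neg (by simp; omega), zero_mul]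
    | cast k =>
      have : ∀ j : Fin (d + 1), ((k.castSucc : ℕ) + 1 = (j : ℕ)) ↔ j = k.succ := by
        intro j
        rw [Fin.ext_iff]
        simp [eq_comm]
      simp only [this]
      rw [Finset.sum_congr rfl (g := fun j => if j = k.succ then
        ((spin d * (spin d + 1) - weight d j * (weight d j + 1) : ℝ) : ℂ) else 0)
        (fun j _ => by
          split_ifs
          · exact ofReal_sqrt_mul_self (raise_coeff_nonneg d _)
          · simp)]
      rw [Finset.sum_ite_eq', if_pos (Finset.mem_univ _)]
      congr 1
      simp only [weight, Fin.val_succ, Fin.val_castSucc]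
      push_cast
      ring
  · rw [diagonal_apply_ne _ hkl]
    refine Finset.sum_eq_zero fun j _ => ?_
    split_ifs with h1 h2
    · exact absurd (Fin.ext (by omega)) hkl
    all_goals simp

theorem spin3_raise_commutator (d : ℕ) :
    spin3 d * spinRaise d - spinRaise d * spin3 d = spinRaise d := by
  ext k l
  rw [spin3, Matrix.sub_apply, diagonal_mul, mul_diagonal]
  simp only [spinRaise, of_apply]
  split_ifs with h
  · have : weight d k = weight d l + 1 := by
      simp only [weight, ← h]
      push_cast
      ring
    rw [this]
    push_cast
    ring
  · simp

theorem raise_lower_commutator (d : ℕ) :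
    spinRaise d * (spinRaise d)ᴴ - (spinRaise d)ᴴ * spinRaise d = (2 : ℂ) • spin3 d := by
  rw [spinRaise_mul_spinLower, spinLower_mul_spinRaise, diagonal_sub, spin3, ← diagonal_smul]
  congr 1
  ext k
  simp only [Pi.smul_apply, smul_eq_mul]
  push_cast
  ring

theorem one_div_two_mul_I : 1 / (2 * Complex.I) = -(Complex.I / 2) := by
  have : (2 : ℂ) * Complex.I ≠ 0 := mul_ne_zero two_ne_zero Complex.I_ne_zero
  rw [div_eq_iff this]
  linear_combination Complex.I_sq

theorem sq_one_div_two_mul_I : (1 / (2 * Complex.I)) * (1 / (2 * Complex.I)) = -(1 / 4) := by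
  rw [one_div_two_mul_I]
  linear_combination (1 / 4) * Complex.I_sq

theorem spin_sq_sum (d : ℕ) :
    spin1 d * spin1 d + spin2 d * spin2 d + spin3 d * spin3 d
      = ((spin d * (spin d + 1) : ℝ) : ℂ) • (1 : Matrix (Fin (d + 1)) (Fin (d + 1)) ℂ) := by
  have h1 : spin1 d * spin1 d + spin2 d * spin2 d
      = (1 / 2 : ℂ) • (spinRaise d * (spinRaise d)ᴴ + (spinRaise d)ᴴ * spinRaise d) := by
    unfold spin1 spin2
    simp only [smul_mul_assoc, mul_smul_comm, add_mul, mul_add, sub_mul, mul_sub, smul_add,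
    smul_sub, smul_smul]
    rw [sq_one_div_two_mul_I]
    module
  rw [h1, spinRaise_mul_spinLower, spinLower_mul_spinRaise, spin3, diagonal_mul_diagonal,
    diagonal_add, ← diagonal_smul, diagonal_add, ← diagonal_one, ← diagonal_smul]
  congr 1
  ext k
  simp only [Pi.smul_apply, smul_eq_mul]
  push_cast
  ring

theorem spin3_conjTranspose (d : ℕ) : (spin3 d)ᴴ = spin3 d := by
  rw [spin3, diagonal_conjTranspose]
  congr 1
  ext k
  simp

theorem spin1_conjTranspose (d : ℕ) : (spin1 d)ᴴ = spin1 d := by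
  rw [spin1, conjTranspose_smul, conjTranspose_add, conjTranspose_conjTranspose,
    add_comm (spinRaise d)ᴴ]
  simp

theorem spin2_conjTranspose (d : ℕ) : (spin2 d)ᴴ = spin2 d := by
  rw [spin2, conjTranspose_smul, conjTranspose_sub, conjTranspose_conjTranspose, ← neg_sub,
    smul_neg, ← neg_smul]
  congr 1
  simp

/-! ### Operators acting on one factor of the tensor power -/

section Site

variable {d n : ℕ}

theorem sum_config_eq_sum_update (i : Fin n) (σ : Config d n) (f : Config d n → ℂ) :
    (∑ τ : Config d n, if ∀ k, k ≠ i → σ k = τ k then f τ else 0)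
      = ∑ v : Fin (d + 1), f (Function.update σ i v) := by
  rw [← Finset.sum_filter]
  have hup : ∀ τ : Config d n, (∀ k, k ≠ i → σ k = τ k) → Function.update σ i (τ i) = τ := by
    intro τ hτ
    funext k
    by_cases hk : k = i
    · subst hk; simp
    · rw [Function.update_of_ne hk, hτ k hk]
  refine Finset.sum_nbij' (fun τ => τ i) (fun v => Function.update σ i v) (by simp) ?_ ?_ (by simp)
    ?_
  · intro v _
    simp only [Finset.mem_filter, Finset.mem_univ, true_and]
    intro k hk
    rw [Function.update_of_ne hk]
  · intro τ hτ
    exact hup τ (Finset.mem_filter.1 hτ).2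
  · intro τ hτ
    rw [hup τ (Finset.mem_filter.1 hτ).2]

theorem site_mul_apply (A : Matrix (Fin (d + 1)) (Fin (d + 1)) ℂ) (i : Fin n)
    (X : Matrix (Config d n) (Config d n) ℂ) (σ ρ : Config d n) :
    (site A i * X) σ ρ = ∑ v, A (σ i) v * X (Function.update σ i v) ρ := by
  rw [mul_apply]
  simp only [site, of_apply, ite_mul, zero_mul]
  rw [sum_config_eq_sum_update i σ fun τ => A (σ i) (τ i) * X τ ρ]
  simp

theorem site_mul_site_self (A B : Matrix (Fin (d + 1)) (Fin (d + 1)) ℂ) (i : Fin n) :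
    site A i * site B i = site (A * B) i := by
  ext σ ρ
  rw [site_mul_apply]
  have h : ∀ v, (∀ k, k ≠ i → Function.update σ i v k = ρ k) ↔ ∀ k, k ≠ i → σ k = ρ k := fun v =>
    forall₂_congr fun k hk => by rw [Function.update_of_ne hk]
  simp only [site, of_apply, Function.update_self, h]
  split_ifs
  · rw [mul_apply]
  · simp

theorem site_mul_site_apply (A B : Matrix (Fin (d + 1)) (Fin (d + 1)) ℂ) {i j : Fin n}
    (hij : i ≠ j) (σ ρ : Config d n) :
    (site A i * site B j) σ ρ
      = if ∀ k, k ≠ i → k ≠ j → σ k = ρ k then A (σ i) (ρ i) * B (σ j) (ρ j) else 0 := by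
  rw [site_mul_apply]
  simp only [site, of_apply, Function.update_of_ne hij.symm]
  rw [Finset.sum_eq_single (ρ i)]
  · have : (∀ k, k ≠ j → Function.update σ i (ρ i) k = ρ k)
        ↔ ∀ k, k ≠ i → k ≠ j → σ k = ρ k := by
      refine forall_congr' fun k => ?_
      by_cases hk : k = i
      · subst hk; simp
      · simp [hk]
    simp only [this]
    split_ifs <;> simp
  · intro v _ hv
    rw [if_neg, mul_zero]
    intro h
    have := h i hij
    rw [Function.update_self] at this
    exact hv this
  · simp

theorem site_commute (A B : Matrix (Fin (d + 1)) (Fin (d + 1)) ℂ) {i j : Fin n} (hij : i ≠ j) :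
    site A i * site B j = site B j * site A i := by
  ext σ ρ
  rw [site_mul_site_apply A B hij, site_mul_site_apply B A hij.symm]
  have : (∀ k, k ≠ i → k ≠ j → σ k = ρ k) ↔ ∀ k, k ≠ j → k ≠ i → σ k = ρ k :=
    forall_congr' fun k => ⟨fun h a b => h b a, fun h a b => h b a⟩
  simp only [this, mul_comm]

theorem site_add (A B : Matrix (Fin (d + 1)) (Fin (d + 1)) ℂ) (i : Fin n) :
    site (A + B) i = site A i + site B i := by
  ext σ ρ
  simp only [site, of_apply, Matrix.add_apply]
  split_ifs <;> simp

theorem site_smul (c : ℂ) (A : Matrix (Fin (d + 1)) (Fin (d + 1)) ℂ) (i : Fin n) :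
    site (c • A) i = c • site A i := by
  ext σ ρ
  simp only [site, of_apply, Matrix.smul_apply]
  split_ifs <;> simp

theorem site_conjTranspose (A : Matrix (Fin (d + 1)) (Fin (d + 1)) ℂ) (i : Fin n) :
    (site A i)ᴴ = site Aᴴ i := by
  ext σ ρ
  have : (∀ k, k ≠ i → ρ k = σ k) ↔ ∀ k, k ≠ i → σ k = ρ k :=
    forall₂_congr fun k _ => eq_comm
  simp only [site, of_apply, conjTranspose_apply, this]
  split_ifs <;> simp

theorem site_diagonal (v : Fin (d + 1) → ℂ) (i : Fin n) :
    site (Matrix.diagonal v) i = Matrix.diagonal fun σ : Config d n => v (σ i) := by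
  ext σ ρ
  simp only [site, of_apply, diagonal_apply]
  by_cases h : σ = ρ
  · subst h; simp
  · rw [if_neg h]
    split_ifs with h1 h2
    · refine absurd (funext fun k => ?_) h
      by_cases hk : k = i
      · subst hk; exact h2
      · exact h1 k hk
    all_goals rfl

theorem site_one (i : Fin n) :
    site (1 : Matrix (Fin (d + 1)) (Fin (d + 1)) ℂ) i = 1 := by
  rw [← diagonal_one, site_diagonal, diagonal_one]

/-! ### Total operators -/

/-- The total operator `∑ᵢ Aᵢ`. -/
def total (n : ℕ) (A : Matrix (Fin (d + 1)) (Fin (d + 1)) ℂ) :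
    Matrix (Config d n) (Config d n) ℂ := ∑ i : Fin n, site A i

theorem total_add (A B : Matrix (Fin (d + 1)) (Fin (d + 1)) ℂ) :
    total n (A + B) = total n A + total n B := by
  simp only [total, site_add, Finset.sum_add_distrib]

theorem total_smul (c : ℂ) (A : Matrix (Fin (d + 1)) (Fin (d + 1)) ℂ) :
    total n (c • A) = c • total n A := by
  simp only [total, site_smul, Finset.smul_sum]

theorem total_sub (A B : Matrix (Fin (d + 1)) (Fin (d + 1)) ℂ) :
    total n (A - B) = total n A - total n B := by
  have := total_smul (n := n) (-1) B
  rw [sub_eq_add_neg, total_add, ← neg_one_smul ℂ B, this, neg_one_smul, ← sub_eq_add_neg]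

theorem total_conjTranspose (A : Matrix (Fin (d + 1)) (Fin (d + 1)) ℂ) :
    (total n A)ᴴ = total n Aᴴ := by
  simp only [total, conjTranspose_sum, site_conjTranspose]

/-- Operators at distinct sites commute, so only the diagonal terms survive; the single-site spin
relations pass to the total spin. -/
theorem total_commutator (A B : Matrix (Fin (d + 1)) (Fin (d + 1)) ℂ) :
    total n A * total n B - total n B * total n A = total n (A * B - B * A) := by
  rw [total_sub]
  simp only [total, Finset.sum_mul_sum]
  rw [Finset.sum_comm (f := fun i j => site B i * site A j), ← Finset.sum_sub_distrib,
    ← Finset.sum_sub_distrib]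
  refine Finset.sum_congr rfl fun i _ => ?_
  rw [← Finset.sum_sub_distrib, Finset.sum_eq_single i]
  · rw [site_mul_site_self, site_mul_site_self]
  · intro j _ hj
    rw [site_commute A B hj.symm, sub_self]
  · simp

theorem total_mul_total (A : Matrix (Fin (d + 1)) (Fin (d + 1)) ℂ) :
    total n A * total n A
      = total n (A * A) + (2 : ℂ) • ∑ i : Fin n, ∑ j ∈ Finset.Ioi i, site A i * site A j := by
  have h := Finset.sum_sum_Ioi_add_eq_sum_sum_off_diag fun i j : Fin n => site A i * site A j
  have h2 : (∑ i : Fin n, ∑ j ∈ Finset.Ioi i, (site A j * site A i + site A i * site A j))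
      = (2 : ℂ) • ∑ i : Fin n, ∑ j ∈ Finset.Ioi i, site A i * site A j := by
    rw [Finset.smul_sum]
    refine Finset.sum_congr rfl fun i _ => ?_
    rw [Finset.smul_sum]
    refine Finset.sum_congr rfl fun j hj => ?_
    rw [site_commute A A (Finset.mem_Ioi.1 hj).ne', two_smul]
  rw [← h2, h]
  simp only [total, Finset.sum_mul_sum]
  rw [Finset.sum_comm, ← Finset.sum_add_distrib]
  refine Finset.sum_congr rfl fun i _ => ?_
  rw [Fintype.sum_eq_add_sum_compl i, site_mul_site_self]

/-- The total weight of a configuration. -/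
def totalWeight (σ : Config d n) : ℝ := ∑ i, weight d (σ i)

theorem total_spin3 :
    total n (spin3 d) = Matrix.diagonal fun σ : Config d n => ((totalWeight σ : ℝ) : ℂ) := by
  have : ∀ s : Finset (Fin n), (∑ i ∈ s, site (spin3 d) i)
      = Matrix.diagonal fun σ : Config d n => ((∑ i ∈ s, weight d (σ i) : ℝ) : ℂ) := by
    intro s
    classical
    induction s using Finset.induction_on with
    | empty => simp
    | insert i s hi ih =>
      rw [Finset.sum_insert hi, ih, spin3, site_diagonal, diagonal_add]
      congr 1
      ext σ
      rw [Finset.sum_insert hi]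
      push_cast
      rfl
  exact this Finset.univ

theorem total_smul_one (c : ℂ) :
    total n (c • (1 : Matrix (Fin (d + 1)) (Fin (d + 1)) ℂ)) = ((n : ℂ) * c) • 1 := by
  simp only [total, site_smul, site_one, Finset.sum_const, Finset.card_univ, Fintype.card_fin,
    mul_smul, Nat.cast_smul_eq_nsmul]

variable (d n)

/-- The square of the total spin. -/
def casimir : Matrix (Config d n) (Config d n) ℂ :=
  total n (spin1 d) * total n (spin1 d) + total n (spin2 d) * total n (spin2 d)
    + total n (spin3 d) * total n (spin3 d)

/-- On the complete graph the pair sum is half of the squared total spin minus the single-site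
squares, and these add up to the scalar `n S(S+1)`. -/
theorem smul_hamiltonian (hn : n ≠ 0) (β : ℝ) :
    (-(β : ℂ)) • hamiltonian d n
      = ((β / n : ℝ) : ℂ) • casimir d n - ((β * (spin d * (spin d + 1)) : ℝ) : ℂ) • 1 := by
  have hn' : (n : ℂ) ≠ 0 := Nat.cast_ne_zero.2 hn
  have h : casimir d n = ((n : ℂ) * ((spin d * (spin d + 1) : ℝ) : ℂ)) • 1
      + (2 : ℂ) • ∑ i : Fin n, ∑ j ∈ Finset.Ioi i,
        (site (spin1 d) i * site (spin1 d) j + site (spin2 d) i * site (spin2 d) j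
          + site (spin3 d) i * site (spin3 d) j) := by
    rw [casimir, total_mul_total, total_mul_total, total_mul_total, ← total_smul_one,
      ← spin_sq_sum, total_add, total_add]
    simp only [Finset.sum_add_distrib, smul_add]
    abel
  rw [hamiltonian, h, smul_add, smul_smul, smul_smul, smul_smul]
  have e1 : ((β / n : ℝ) : ℂ) * ((n : ℂ) * ((spin d * (spin d + 1) : ℝ) : ℂ))
      = ((β * (spin d * (spin d + 1)) : ℝ) : ℂ) := by
    push_cast
    field_simp
  have e2 : -(β : ℂ) * -(2 / (n : ℂ)) = ((β / n : ℝ) : ℂ) * 2 := by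
    push_cast
    ring
  rw [e1, e2, add_sub_cancel_left]

variable {d n}

/-! ### Commutation relations of the total spin -/

theorem total_spin3_raise :
    total n (spin3 d) * total n (spinRaise d) - total n (spinRaise d) * total n (spin3 d)
      = total n (spinRaise d) := by
  rw [total_commutator, spin3_raise_commutator]

theorem total_spin3_lower :
    total n (spin3 d) * total n (spinRaise d)ᴴ - total n (spinRaise d)ᴴ * total n (spin3 d)
      = -total n (spinRaise d)ᴴ := by
  have h := congrArg conjTranspose (total_spin3_raise (d := d) (n := n))
  rw [conjTranspose_sub, conjTranspose_mul, conjTranspose_mul, total_conjTranspose,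
    total_conjTranspose, spin3_conjTranspose] at h
  rw [← neg_sub, h]

theorem total_raise_lower :
    total n (spinRaise d) * total n (spinRaise d)ᴴ - total n (spinRaise d)ᴴ * total n (spinRaise d)
      = (2 : ℂ) • total n (spin3 d) := by
  rw [total_commutator, raise_lower_commutator, total_smul]

theorem total_spin1 :
    total n (spin1 d) = (1 / 2 : ℂ) • (total n (spinRaise d) + total n (spinRaise d)ᴴ) := by
  rw [spin1, total_smul, total_add]

theorem total_spin2 :
    total n (spin2 d)
      = (1 / (2 * Complex.I)) • (total n (spinRaise d) - total n (spinRaise d)ᴴ) := by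
  rw [spin2, total_smul, total_sub]

theorem casimir_eq :
    casimir d n = total n (spinRaise d)ᴴ * total n (spinRaise d)
      + total n (spin3 d) * total n (spin3 d) + total n (spin3 d) := by
  have h := total_raise_lower (d := d) (n := n)
  rw [casimir, total_spin1, total_spin2]
  simp only [smul_mul_assoc, mul_smul_comm, add_mul, mul_add, sub_mul, mul_sub, smul_add,
    smul_sub, smul_smul]
  rw [sq_one_div_two_mul_I]
  linear_combination (norm := module) (1 / 2 : ℂ) • h

theorem casimir_commute_spin3 : Commute (casimir d n) (total n (spin3 d)) := by
  have h1 := total_spin3_raise (d := d) (n := n)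
  have h2 := total_spin3_lower (d := d) (n := n)
  rw [casimir_eq]
  generalize total n (spin3 d) = a at *
  generalize total n (spinRaise d) = p at *
  generalize total n (spinRaise d)ᴴ = m at *
  rw [Commute, SemiconjBy]
  linear_combination (norm := noncomm_ring) -(m * h1) - h2 * p

theorem casimir_commute_raise : Commute (casimir d n) (total n (spinRaise d)) := by
  have h1 := total_spin3_raise (d := d) (n := n)
  have h3 := total_raise_lower (d := d) (n := n)
  rw [casimir_eq]
  generalize total n (spin3 d) = a at *
  generalize total n (spinRaise d) = p at *
  generalize total n (spinRaise d)ᴴ = m at *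
  rw [two_smul] at h3
  rw [Commute, SemiconjBy]
  linear_combination (norm := noncomm_ring) -(h3 * p) + a * h1 + h1 * a

theorem casimir_conjTranspose : (casimir d n)ᴴ = casimir d n := by
  rw [casimir_eq]
  simp only [conjTranspose_add, conjTranspose_mul, total_conjTranspose,
    conjTranspose_conjTranspose, spin3_conjTranspose]

theorem casimir_commute_lower : Commute (casimir d n) (total n (spinRaise d)ᴴ) := by
  have h := congrArg conjTranspose (casimir_commute_raise (d := d) (n := n)).eq
  rw [conjTranspose_mul, conjTranspose_mul, total_conjTranspose, casimir_conjTranspose] at h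
  exact h.symm

theorem casimir_commute_spin1 : Commute (casimir d n) (total n (spin1 d)) := by
  rw [total_spin1]
  exact (casimir_commute_raise.add_right casimir_commute_lower).smul_right _

theorem casimir_commute_spin2 : Commute (casimir d n) (total n (spin2 d)) := by
  rw [total_spin2]
  exact (casimir_commute_raise.sub_right casimir_commute_lower).smul_right _

theorem total_spin2_spin1 :
    total n (spin2 d) * total n (spin1 d) - total n (spin1 d) * total n (spin2 d)
      = -(Complex.I • total n (spin3 d)) := by
  have h := total_raise_lower (d := d) (n := n)
  rw [total_spin1, total_spin2]
  simp only [smul_mul_assoc, mul_smul_comm, add_mul, mul_add, sub_mul, mul_sub, smul_add,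
    smul_sub, smul_smul]
  rw [one_div_two_mul_I]
  linear_combination (norm := module) (-(Complex.I / 2)) • h

theorem total_spin2_spin3 :
    total n (spin2 d) * total n (spin3 d) - total n (spin3 d) * total n (spin2 d)
      = Complex.I • total n (spin1 d) := by
  have h1 := total_spin3_raise (d := d) (n := n)
  have h2 := total_spin3_lower (d := d) (n := n)
  rw [total_spin1, total_spin2]
  simp only [smul_mul_assoc, mul_smul_comm, smul_smul, mul_sub, sub_mul]
  rw [one_div_two_mul_I]
  linear_combination (norm := module) (Complex.I / 2) • h1 - (Complex.I / 2) • h2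

end Site

end

section

open Matrix

/-! ### Positivity, rotations and diagonal entries of matrix exponentials -/

theorem re_conjTranspose_mul_self_nonneg {ι : Type*} [Fintype ι] (A : Matrix ι ι ℂ)
    (i : ι) : 0 ≤ ((Aᴴ * A) i i).re := by
  rw [mul_apply, Complex.re_sum]
  refine Finset.sum_nonneg fun j _ => ?_
  rw [conjTranspose_apply, Complex.star_def, mul_comm, Complex.mul_conj, Complex.ofReal_re]
  exact Complex.normSq_nonneg _

theorem re_trace_conjTranspose_mul_self_nonneg {ι : Type*} [Fintype ι] (A : Matrix ι ι ℂ) :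
    0 ≤ (Aᴴ * A).trace.re := by
  rw [trace, Complex.re_sum]
  exact Finset.sum_nonneg fun i _ => re_conjTranspose_mul_self_nonneg A i

section MatrixExp

variable {ι : Type*} [Fintype ι] [DecidableEq ι]

open scoped Matrix.Norms.Operator in
theorem hasDerivAt_linearMap_exp (L : Matrix ι ι ℂ →ₗ[ℝ] ℝ) (C : Matrix ι ι ℂ) (t : ℝ) :
    HasDerivAt (fun s : ℝ => L (NormedSpace.exp (s • C))) (L (NormedSpace.exp (t • C) * C)) t :=
  (LinearMap.toContinuousLinearMap L).hasFDerivAt.comp_hasDerivAt t (hasDerivAt_exp_smul_const C t)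

open scoped Matrix.Norms.Operator in
/-- Conjugation by `exp (θ K)` rotates the plane spanned by `X` and `Y`. -/
theorem exp_mul_rotate_mul_exp {K X Y : Matrix ι ι ℂ} (hX : K * X - X * K = -Y)
    (hY : K * Y - Y * K = X) (θ : ℝ) :
    NormedSpace.exp (θ • K) * (Real.cos θ • X + Real.sin θ • Y) * NormedSpace.exp (θ • -K) = X := by
  set F : ℝ → Matrix ι ι ℂ := fun θ =>
    NormedSpace.exp (θ • K) * (Real.cos θ • X + Real.sin θ • Y) * NormedSpace.exp (θ • -K) with hF
  have hder : ∀ θ, HasDerivAt F 0 θ := fun θ => by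
    have h1 := hasDerivAt_exp_smul_const K θ
    have h2 := hasDerivAt_exp_smul_const' (-K) θ
    have h3 := ((Real.hasDerivAt_cos θ).smul_const X).add ((Real.hasDerivAt_sin θ).smul_const Y)
    refine ((h1.mul h3).mul h2).congr_deriv ?_
    have e : K * (Real.cos θ • X + Real.sin θ • Y) + (-Real.sin θ • X + Real.cos θ • Y)
        - (Real.cos θ • X + Real.sin θ • Y) * K = 0 := by
      simp only [mul_add, add_mul, mul_smul_comm, smul_mul_assoc]
      linear_combination (norm := module) Real.cos θ • hX + Real.sin θ • hY
    have alg : ∀ E Z Z' E' : Matrix ι ι ℂ, (E * K * Z + E * Z') * E' + E * Z * (-K * E')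
        = E * (K * Z + Z' - Z * K) * E' := fun E Z Z' E' => by noncomm_ring
    refine (alg _ _ _ _).trans ?_
    simp only [Pi.add_apply]
    rw [e, mul_zero, zero_mul]
  have hconst := is_const_of_deriv_eq_zero (fun θ => (hder θ).differentiableAt)
    (fun θ => (hder θ).deriv) θ 0
  change F θ = X
  rw [hconst, hF]
  simp

/-- A quarter turn about `K`, in the direction chosen by the sign of `h`; this is how `|h|` enters.
-/
theorem exists_conj_of_rotate {K X Y C : Matrix ι ι ℂ} (hX : K * X - X * K = -Y)
    (hY : K * Y - Y * K = X) (hC : Commute K C) (h : ℝ) :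
    ∃ U : Matrix ι ι ℂ, IsUnit U ∧ h • X = U * (|h| • Y) * U⁻¹ ∧ C = U * C * U⁻¹ := by
  have key : ∀ θ : ℝ, C = NormedSpace.exp (θ • K) * C * (NormedSpace.exp (θ • K))⁻¹ := fun θ => by
    have hc : Commute (NormedSpace.exp (θ • K)) C := (hC.smul_left θ).exp_left
    have hu := (isUnit_iff_isUnit_det _).1 (isUnit_exp (θ • K))
    rw [hc.eq, mul_assoc, mul_nonsing_inv _ hu, mul_one]
  have rot := fun θ => exp_mul_rotate_mul_exp hX hY θ
  have hneg : ∀ θ : ℝ, NormedSpace.exp (θ • -K) = (NormedSpace.exp (θ • K))⁻¹ := fun θ => by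
    rw [smul_neg, Matrix.exp_neg]
  simp only [hneg] at rot
  rcases le_total 0 h with h0 | h0
  · refine ⟨NormedSpace.exp ((Real.pi / 2) • K), isUnit_exp _, ?_, key _⟩
    have := rot (Real.pi / 2)
    rw [Real.cos_pi_div_two, Real.sin_pi_div_two, zero_smul, zero_add, one_smul] at this
    rw [abs_of_nonneg h0, mul_smul_comm, smul_mul_assoc, this]
  · refine ⟨NormedSpace.exp ((-(Real.pi / 2)) • K), isUnit_exp _, ?_, key _⟩
    have := rot (-(Real.pi / 2))
    rw [Real.cos_neg, Real.sin_neg, Real.cos_pi_div_two, Real.sin_pi_div_two, zero_smul, zero_add]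
      at this
    rw [abs_of_nonpos h0, show (-h) • Y = h • ((-1 : ℝ) • Y) by module, mul_smul_comm,
      smul_mul_assoc, this]

theorem trace_conj {U : Matrix ι ι ℂ} (hU : IsUnit U) (A : Matrix ι ι ℂ) :
    (U * A * U⁻¹).trace = A.trace := by
  rw [trace_mul_comm, ← mul_assoc, nonsing_inv_mul _ ((isUnit_iff_isUnit_det _).1 hU), one_mul]

/-- The real part of a diagonal entry of `exp (t C)`. -/
def diagExp (C : Matrix ι ι ℂ) (t : ℝ) (i : ι) : ℝ := (NormedSpace.exp (t • C) i i).re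

theorem exp_smul_conjTranspose {C : Matrix ι ι ℂ} (hC : Cᴴ = C) (t : ℝ) :
    (NormedSpace.exp (t • C))ᴴ = NormedSpace.exp (t • C) := by
  rw [← exp_conjTranspose, conjTranspose_smul, hC]
  simp

theorem exp_smul_eq_half_mul_half (C : Matrix ι ι ℂ) (t : ℝ) :
    NormedSpace.exp (t • C) = NormedSpace.exp ((t / 2) • C) * NormedSpace.exp ((t / 2) • C) := by
  rw [← exp_add_of_commute _ _ (Commute.refl _), ← add_smul, add_halves]

theorem diagExp_eq {C : Matrix ι ι ℂ} (hC : Cᴴ = C) (t : ℝ) (i : ι) :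
    NormedSpace.exp (t • C) i i = ((diagExp C t i : ℝ) : ℂ) := by
  have h := congrFun (congrFun (exp_smul_conjTranspose hC t) i) i
  rw [conjTranspose_apply] at h
  exact (Complex.conj_eq_iff_re.1 h).symm

theorem trace_diagonal_mul_exp {C : Matrix ι ι ℂ} {M : ι → ℝ} (hC : Cᴴ = C)
    (hcomm : Commute C (Matrix.diagonal fun i => (M i : ℂ))) (v : ι → ℝ) (t s : ℝ) :
    ((Matrix.diagonal fun i => (v i : ℂ)) *
        NormedSpace.exp (t • C + s • Matrix.diagonal fun i => (M i : ℂ))).trace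
      = ((∑ i, v i * (diagExp C t i * Real.exp (s * M i)) : ℝ) : ℂ) := by
  rw [exp_add_of_commute _ _ ((hcomm.smul_left t).smul_right s), ← diagonal_smul, exp_diagonal,
    trace, Complex.ofReal_sum]
  refine Finset.sum_congr rfl fun i _ => ?_
  rw [diag_apply, diagonal_mul, mul_diagonal, diagExp_eq hC, Pi.coe_exp, ← Complex.exp_eq_exp_ℂ]
  simp [Complex.real_smul]

/-! ### Ladder operators -/

section Ladder

variable {C P : Matrix ι ι ℂ} {M : ι → ℝ}

/-- `C` is `M(M+1)` plus the positive operator `Pᴴ P`, and `exp (sC) Pᴴ P` is again of the form `Bᴴ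
B` with `B = P exp (sC/2)`. So each diagonal entry `y` satisfies `y' ≥ M(M+1) y` and `y(0) = 1`, and
a Grönwall argument concludes. -/
theorem diagExp_ge (hherm : Cᴴ = C) (hcomm : Commute C P)
    (hC : C = Pᴴ * P + (Matrix.diagonal fun i => (M i : ℂ)) * (Matrix.diagonal fun i => (M i : ℂ))
      + Matrix.diagonal fun i => (M i : ℂ)) {t : ℝ} (ht : 0 ≤ t) (i : ι) :
    Real.exp (t * (M i * (M i + 1))) ≤ diagExp C t i := by
  set r := M i * (M i + 1) with hr
  let L : Matrix ι ι ℂ →ₗ[ℝ] ℝ :=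
    { toFun := fun X => (X i i).re
      map_add' := fun X Y => by simp
      map_smul' := fun c X => by simp }
  have hd : ∀ s : ℝ, HasDerivAt (fun s => diagExp C s i)
      ((NormedSpace.exp (s • C) * C) i i).re s := fun s => hasDerivAt_linearMap_exp L C s
  have hpos : ∀ s : ℝ, r * diagExp C s i ≤ ((NormedSpace.exp (s • C) * C) i i).re := fun s => by
    set E := NormedSpace.exp ((s / 2) • C) with hE
    have hEh : Eᴴ = E := exp_smul_conjTranspose hherm _
    have hEP : Commute E P := (hcomm.smul_left _).exp_left
    have h1 : NormedSpace.exp (s • C) * (Pᴴ * P) = (P * E)ᴴ * (P * E) := by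
      rw [exp_smul_eq_half_mul_half, ← hE, conjTranspose_mul, hEh]
      have h2 : Commute E Pᴴ := by
        have := congrArg conjTranspose hEP.eq
        rw [conjTranspose_mul, conjTranspose_mul, hEh] at this
        exact this.symm
      calc E * E * (Pᴴ * P) = E * (E * Pᴴ) * P := by simp only [mul_assoc]
        _ = E * (Pᴴ * E) * P := by rw [h2.eq]
        _ = E * Pᴴ * (E * P) := by simp only [mul_assoc]
        _ = E * Pᴴ * (P * E) := by rw [hEP.eq]
    have h3 := re_conjTranspose_mul_self_nonneg (P * E) i
    rw [← h1] at h3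
    have h4 : NormedSpace.exp (s • C) * C = NormedSpace.exp (s • C) * (Pᴴ * P)
        + NormedSpace.exp (s • C) * Matrix.diagonal fun i => ((M i * (M i + 1) : ℝ) : ℂ) := by
      have hC' : C = Pᴴ * P + Matrix.diagonal fun i => ((M i * (M i + 1) : ℝ) : ℂ) := by
        rw [hC, add_assoc, diagonal_mul_diagonal, diagonal_add]
        congr 2
        ext j
        push_cast
        ring
      exact (congrArg (NormedSpace.exp (s • C) * ·) hC').trans (mul_add _ _ _)
    rw [h4, Matrix.add_apply, Complex.add_re, mul_diagonal, diagExp_eq hherm, ← Complex.ofReal_mul,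
      Complex.ofReal_re, mul_comm (diagExp C s i)]
    linarith
  have hmono : Monotone fun s => diagExp C s i * Real.exp (-s * r) := by
    have hd2 : ∀ s, HasDerivAt (fun s => diagExp C s i * Real.exp (-s * r))
        ((((NormedSpace.exp (s • C) * C) i i).re - r * diagExp C s i) * Real.exp (-s * r)) s :=
      fun s => by
        have h1 : HasDerivAt (fun s : ℝ => -s * r) (-1 * r) s :=
          ((hasDerivAt_id s).neg).mul_const r
        refine ((hd s).mul h1.exp).congr_deriv ?_
        ring
    refine monotone_of_deriv_nonneg (fun s => (hd2 s).differentiableAt) fun s => ?_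
    rw [(hd2 s).deriv]
    exact mul_nonneg (sub_nonneg.2 (hpos s)) (Real.exp_pos _).le
  have h0 := hmono ht
  simp only [neg_zero, zero_mul, Real.exp_zero, mul_one] at h0
  have h1 : diagExp C 0 i = 1 := by simp [diagExp]
  rw [h1, neg_mul, Real.exp_neg, ← div_eq_mul_inv, le_div_iff₀ (Real.exp_pos _), one_mul] at h0
  exact h0

/-- The projection onto the level `M = r`. -/
def levelProj (M : ι → ℝ) (r : ℝ) : Matrix ι ι ℂ :=
  Matrix.diagonal fun i => if M i = r then 1 else 0

/-- The commutation relation forces every nonzero entry of `P` to join a level to the one just above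
it. -/
theorem raise_mul_levelProj (hlad : (Matrix.diagonal fun i => (M i : ℂ)) * P
      - P * (Matrix.diagonal fun i => (M i : ℂ)) = P) (r : ℝ) :
    P * levelProj M r = levelProj M (r + 1) * P := by
  ext i j
  rw [levelProj, levelProj, mul_diagonal, diagonal_mul]
  have h := congrFun (congrFun hlad i) j
  rw [Matrix.sub_apply, diagonal_mul, mul_diagonal] at h
  by_cases hP : P i j = 0
  · simp [hP]
  · have h1 : (M i : ℂ) = M j + 1 := by
      have : P i j * ((M i : ℂ) - (M j + 1)) = 0 := by linear_combination h
      exact sub_eq_zero.1 ((mul_eq_zero.1 this).resolve_left hP)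
    have h2 : M i = M j + 1 := by exact_mod_cast h1
    rw [h2]
    simp [mul_comm]

theorem diagonal_mul_levelProj (r : ℝ) :
    (Matrix.diagonal fun i => (M i : ℂ)) * levelProj M r = (r : ℂ) • levelProj M r := by
  rw [levelProj, diagonal_mul_diagonal, ← diagonal_smul]
  congr 1
  ext i
  simp only [Pi.smul_apply, smul_eq_mul]
  split_ifs with h
  · rw [h]
  · simp

/-- The contribution of the level `M = r` to the trace of `exp (t C)`. -/
def levelSum (C : Matrix ι ι ℂ) (M : ι → ℝ) (t r : ℝ) : ℝ :=
  ∑ i with M i = r, diagExp C t i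

theorem levelSum_eq_trace (t r : ℝ) :
    levelSum C M t r = (NormedSpace.exp (t • C) * levelProj M r).trace.re := by
  rw [levelSum, trace, Complex.re_sum, Finset.sum_filter]
  refine Finset.sum_congr rfl fun i _ => ?_
  rw [diag_apply, levelProj, mul_diagonal]
  split_ifs <;> simp [diagExp]

theorem levelSum_zero (r : ℝ) :
    levelSum C M 0 r = (Finset.univ.filter fun i => M i = r).card := by
  simp [levelSum, diagExp]

theorem hasDerivAt_levelSum (t r : ℝ) :
    HasDerivAt (fun s => levelSum C M s r)
      (NormedSpace.exp (t • C) * C * levelProj M r).trace.re t := by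
  let L : Matrix ι ι ℂ →ₗ[ℝ] ℝ :=
    { toFun := fun X => (X * levelProj M r).trace.re
      map_add' := fun X Y => by simp [add_mul]
      map_smul' := fun c X => by simp }
  have := hasDerivAt_linearMap_exp L C t
  refine this.congr_of_eventuallyEq (Eventually.of_forall fun s => ?_)
  exact levelSum_eq_trace s r

/-- The difference of two consecutive level sums. -/
theorem levelSum_sub (hcomm : Commute C P)
    (hlad : (Matrix.diagonal fun i => (M i : ℂ)) * P
      - P * (Matrix.diagonal fun i => (M i : ℂ)) = P)
    (hPP : P * Pᴴ - Pᴴ * P = (2 : ℂ) • Matrix.diagonal fun i => (M i : ℂ))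
    (hC : C = Pᴴ * P + (Matrix.diagonal fun i => (M i : ℂ)) * (Matrix.diagonal fun i => (M i : ℂ))
      + Matrix.diagonal fun i => (M i : ℂ)) (t r : ℝ) :
    levelSum C M t r - levelSum C M t (r + 1)
      = Real.exp (t * (r * (r + 1))) * (levelSum C M 0 r - levelSum C M 0 (r + 1)) := by
  set D : Matrix ι ι ℂ := Matrix.diagonal fun i => (M i : ℂ) with hD
  -- The difference solves `y' = r(r+1) y`. On level `r`, `C = Pᴴ P + r(r+1)`; on level `r+1`, `C =
  -- P Pᴴ + r(r+1)`, as `(r+1)² - (r+1) = r(r+1)`. The two ladder terms have the same trace by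
  -- cyclicity, since `P` maps one level into the next.
  have hder : ∀ s, (NormedSpace.exp (s • C) * C * levelProj M r).trace.re
      - (NormedSpace.exp (s • C) * C * levelProj M (r + 1)).trace.re
      = r * (r + 1) * (levelSum C M s r - levelSum C M s (r + 1)) := fun s => by
    rw [levelSum_eq_trace, levelSum_eq_trace]
    set E := NormedSpace.exp (s • C) with hE
    have hEP : Commute E P := (hcomm.smul_left _).exp_left
    have h1 : (E * Pᴴ * P * levelProj M r).trace = (E * P * Pᴴ * levelProj M (r + 1)).trace := by
      rw [mul_assoc, raise_mul_levelProj hlad, ← mul_assoc, trace_mul_comm, ← mul_assoc,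
        ← mul_assoc, hEP.eq]
    have h2 : E * C * levelProj M r
        = E * Pᴴ * P * levelProj M r + ((r * (r + 1) : ℝ) : ℂ) • (E * levelProj M r) := by
      have : C * levelProj M r
          = Pᴴ * P * levelProj M r + D * (D * levelProj M r) + D * levelProj M r := by
        conv_lhs => rw [hC]
        noncomm_ring
      rw [mul_assoc, this, diagonal_mul_levelProj, mul_smul_comm, diagonal_mul_levelProj]
      simp only [mul_add, mul_smul_comm, ← mul_assoc]
      push_cast
      module
    have h3 : E * C * levelProj M (r + 1)
        = E * P * Pᴴ * levelProj M (r + 1)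
          + ((r * (r + 1) : ℝ) : ℂ) • (E * levelProj M (r + 1)) := by
      have : C * levelProj M (r + 1)
          = P * Pᴴ * levelProj M (r + 1) + D * (D * levelProj M (r + 1))
            - D * levelProj M (r + 1) := by
        have hC' : C = P * Pᴴ + D * D - D := by
          rw [hC]
          linear_combination (norm := module) -hPP
        conv_lhs => rw [hC']
        noncomm_ring
      rw [mul_assoc, this, diagonal_mul_levelProj, mul_smul_comm, diagonal_mul_levelProj]
      simp only [mul_add, mul_sub, mul_smul_comm, ← mul_assoc]
      push_cast
      module
    rw [h2, h3, trace_add, trace_add, h1, trace_smul, trace_smul, smul_eq_mul, smul_eq_mul,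
      Complex.add_re, Complex.add_re, Complex.re_ofReal_mul, Complex.re_ofReal_mul]
    ring
  set G : ℝ → ℝ := fun s => (levelSum C M s r - levelSum C M s (r + 1))
    * Real.exp (-s * (r * (r + 1))) with hG
  have hdG : ∀ s, HasDerivAt G 0 s := fun s => by
    have h1 : HasDerivAt (fun s : ℝ => -s * (r * (r + 1))) (-1 * (r * (r + 1))) s :=
      ((hasDerivAt_id s).neg).mul_const _
    have h2 := ((hasDerivAt_levelSum (C := C) (M := M) s r).sub
      (hasDerivAt_levelSum (C := C) (M := M) s (r + 1))).mul h1.exp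
    refine h2.congr_deriv ?_
    simp only [Pi.sub_apply]
    rw [hder]
    ring
  have hc := is_const_of_deriv_eq_zero (fun s => (hdG s).differentiableAt)
    (fun s => (hdG s).deriv) t 0
  simp only [hG, neg_zero, zero_mul, Real.exp_zero, mul_one] at hc
  rw [← hc, mul_left_comm, ← Real.exp_add]
  simp

end Ladder

end MatrixExp

end

section

open Matrix

section Model

variable {d n : ℕ}

/-! ### Reduction of the traces to weighted sums over configurations -/

theorem ofReal_smul_matrix {ι : Type*} (r : ℝ) (A : Matrix ι ι ℂ) : (r : ℂ) • A = r • A := by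
  ext i j
  simp [Complex.real_smul]

theorem gibbs_eq (hn : n ≠ 0) (β h : ℝ) :
    gibbs d n β h = Real.exp (-(β * (spin d * (spin d + 1)))) •
      NormedSpace.exp ((β / n) • casimir d n + h • total n (spin1 d)) := by
  set c := β * (spin d * (spin d + 1))
  have e1 : (-(β : ℂ)) • hamiltonian d n + (h : ℂ) • ∑ i : Fin n, site (spin1 d) i
      = ((β / n) • casimir d n + h • total n (spin1 d))
        + Matrix.diagonal fun _ => ((-c : ℝ) : ℂ) := by
    rw [smul_hamiltonian d n hn, ofReal_smul_matrix (β / n), ofReal_smul_matrix h,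
      ← total, ← smul_one_eq_diagonal]
    rw [Complex.ofReal_neg, neg_smul]
    abel
  have hc : Commute ((β / n) • casimir d n + h • total n (spin1 d))
      (Matrix.diagonal fun _ => ((-c : ℝ) : ℂ)) := by
    rw [← smul_one_eq_diagonal]
    exact (Commute.one_right _).smul_right _
  rw [gibbs, e1, exp_add_of_commute _ _ hc, exp_diagonal, Pi.exp_def, ← smul_one_eq_diagonal,
    mul_smul_comm, mul_one, ← Complex.exp_eq_exp_ℂ, ← Complex.ofReal_exp, ofReal_smul_matrix]

/-- The generator of the rotation is `-i` times the total `S^(2)`, which commutes with the Casimir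
operator. -/
theorem exists_conj_total_spin1 (h : ℝ) :
    ∃ U : Matrix (Config d n) (Config d n) ℂ, IsUnit U ∧
      h • total n (spin1 d) = U * (|h| • total n (spin3 d)) * U⁻¹ ∧
      casimir d n = U * casimir d n * U⁻¹ := by
  have hI : -Complex.I * -Complex.I = -1 := by simp
  refine exists_conj_of_rotate (K := (-Complex.I) • total n (spin2 d)) ?_ ?_
    (casimir_commute_spin2.symm.smul_left _) h
  · rw [smul_mul_assoc, mul_smul_comm, ← smul_sub, total_spin2_spin1, ← neg_smul, smul_smul, hI,
      neg_one_smul]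
  · rw [smul_mul_assoc, mul_smul_comm, ← smul_sub, total_spin2_spin3, smul_smul]
    simp

/-- The partition function `Tr exp (t C + h S³)` as a sum over configurations. -/
def partitionSum (d n : ℕ) (t h : ℝ) : ℝ :=
  ∑ σ : Config d n, diagExp (casimir d n) t σ * Real.exp (h * totalWeight σ)

theorem casimir_commute_diagonal :
    Commute (casimir d n) (Matrix.diagonal fun σ => ((totalWeight σ : ℝ) : ℂ)) := by
  rw [← total_spin3]
  exact casimir_commute_spin3

theorem trace_exp_spin1 (t h : ℝ) :
    (NormedSpace.exp (t • casimir d n + h • total n (spin1 d))).trace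
      = ((partitionSum d n t |h| : ℝ) : ℂ) := by
  obtain ⟨U, hU, h1, h2⟩ := exists_conj_total_spin1 (d := d) (n := n) h
  have e : t • casimir d n + h • total n (spin1 d)
      = U * (t • casimir d n + |h| • total n (spin3 d)) * U⁻¹ := by
    rw [h1, mul_add, add_mul, mul_smul_comm t, smul_mul_assoc t, ← h2]
  rw [e, exp_conj _ _ hU, trace_conj hU, total_spin3]
  have := trace_diagonal_mul_exp casimir_conjTranspose casimir_commute_diagonal
    (fun _ : Config d n => 1) t |h|
  simpa [partitionSum] using this

theorem trace_spin1_mul_exp (t : ℝ) {h : ℝ} (hh : 0 < h) :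
    (total n (spin1 d) * NormedSpace.exp (t • casimir d n + h • total n (spin1 d))).trace
      = ((∑ σ : Config d n, totalWeight σ * (diagExp (casimir d n) t σ
          * Real.exp (h * totalWeight σ)) : ℝ) : ℂ) := by
  obtain ⟨U, hU, h1, h2⟩ := exists_conj_total_spin1 (d := d) (n := n) h
  rw [abs_of_pos hh] at h1
  have e : t • casimir d n + h • total n (spin1 d)
      = U * (t • casimir d n + h • total n (spin3 d)) * U⁻¹ := by
    rw [h1, mul_add, add_mul, mul_smul_comm t, smul_mul_assoc t, ← h2]
  have h3 : total n (spin1 d) = U * total n (spin3 d) * U⁻¹ := by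
    rw [mul_smul_comm, smul_mul_assoc] at h1
    exact smul_right_injective _ hh.ne' h1
  have h4 : U * total n (spin3 d) * U⁻¹ * (U * NormedSpace.exp (t • casimir d n
      + h • total n (spin3 d)) * U⁻¹)
      = U * (total n (spin3 d) * NormedSpace.exp (t • casimir d n + h • total n (spin3 d)))
        * U⁻¹ := by
    have hu := nonsing_inv_mul _ ((isUnit_iff_isUnit_det _).1 hU)
    calc _ = U * total n (spin3 d) * (U⁻¹ * U) * NormedSpace.exp (t • casimir d n
          + h • total n (spin3 d)) * U⁻¹ := by simp only [mul_assoc]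
      _ = _ := by rw [hu, mul_one]; simp only [mul_assoc]
  rw [e, exp_conj _ _ hU, h3, h4, trace_conj hU, total_spin3]
  exact trace_diagonal_mul_exp casimir_conjTranspose casimir_commute_diagonal _ t h

theorem trace_gibbs (hn : n ≠ 0) (β h : ℝ) :
    (gibbs d n β h).trace
      = ((Real.exp (-(β * (spin d * (spin d + 1)))) * partitionSum d n (β / n) |h| : ℝ) : ℂ) := by
  rw [gibbs_eq hn, trace_smul, trace_exp_spin1, Complex.real_smul, Complex.ofReal_mul]

/-! ### Bounds on the partition function -/

theorem casimir_eq_diagonal :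
    casimir d n = (total n (spinRaise d))ᴴ * total n (spinRaise d)
      + (Matrix.diagonal fun σ => ((totalWeight σ : ℝ) : ℂ))
        * (Matrix.diagonal fun σ => ((totalWeight σ : ℝ) : ℂ))
      + Matrix.diagonal fun σ => ((totalWeight σ : ℝ) : ℂ) := by
  rw [← total_spin3, total_conjTranspose, casimir_eq]

theorem exp_le_diagExp_casimir {t : ℝ} (ht : 0 ≤ t) (σ : Config d n) :
    Real.exp (t * (totalWeight σ * (totalWeight σ + 1))) ≤ diagExp (casimir d n) t σ :=
  diagExp_ge casimir_conjTranspose casimir_commute_raise casimir_eq_diagonal ht σ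

theorem diagExp_casimir_pos {t : ℝ} (ht : 0 ≤ t) (σ : Config d n) :
    0 < diagExp (casimir d n) t σ :=
  (Real.exp_pos _).trans_le (exp_le_diagExp_casimir ht σ)

theorem partitionSum_pos {t : ℝ} (ht : 0 ≤ t) (h : ℝ) : 0 < partitionSum d n t h :=
  Finset.sum_pos (fun σ _ => mul_pos (diagExp_casimir_pos ht σ) (Real.exp_pos _))
    Finset.univ_nonempty

theorem levelSum_casimir_le {t : ℝ} (r : ℝ) :
    levelSum (casimir d n) totalWeight t r ≤ levelSum (casimir d n) totalWeight t (r + 1)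
      + Real.exp (t * (r * (r + 1)))
        * ((Finset.univ.filter fun σ : Config d n => totalWeight σ = r).card : ℝ) := by
  have h := levelSum_sub (C := casimir d n) (P := total n (spinRaise d)) (M := totalWeight)
    casimir_commute_raise (by rw [← total_spin3, total_spin3_raise])
    (by rw [← total_spin3, total_conjTranspose, total_raise_lower]) casimir_eq_diagonal t r
  rw [levelSum_zero, levelSum_zero, mul_sub] at h
  have : 0 ≤ Real.exp (t * (r * (r + 1)))
      * ((Finset.univ.filter fun σ : Config d n => totalWeight σ = r + 1).card : ℝ) := by
    positivity
  linarith

theorem abs_totalWeight_le (σ : Config d n) : |totalWeight σ| ≤ n * spin d := by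
  refine (Finset.abs_sum_le_sum_abs _ _).trans ?_
  refine (Finset.sum_le_sum fun i _ => abs_weight_le d (σ i)).trans ?_
  simp

theorem totalWeight_eq (σ : Config d n) :
    totalWeight σ = n * spin d - ((∑ i, (σ i : ℕ) : ℕ) : ℝ) := by
  simp [totalWeight, weight, Finset.sum_sub_distrib]

theorem sum_exp_totalWeight (d n : ℕ) (x : ℝ) :
    ∑ σ : Config d n, Real.exp (x * totalWeight σ) = Real.exp (n * eta d x) := by
  rw [Real.exp_nat_mul, exp_eta, siteZ, Fintype.sum_pow]
  refine Finset.sum_congr rfl fun σ _ => ?_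
  rw [← Real.exp_sum, totalWeight, Finset.mul_sum]

/-- Chernoff bound: the sum of `exp (x M)` over all configurations is `exp (n η(x))`, and each
configuration in the level contributes `exp (x r)`. -/
theorem card_level_le (d n : ℕ) (x r : ℝ) :
    ((Finset.univ.filter fun σ : Config d n => totalWeight σ = r).card : ℝ)
      ≤ Real.exp (n * eta d x - x * r) := by
  rw [Real.exp_sub, le_div_iff₀ (Real.exp_pos _), ← sum_exp_totalWeight, ← nsmul_eq_mul,
    ← Finset.sum_const]
  calc _ = ∑ σ : Config d n with totalWeight σ = r, Real.exp (x * totalWeight σ) :=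
        Finset.sum_congr rfl fun σ hσ => by rw [(Finset.mem_filter.1 hσ).2]
    _ ≤ _ := Finset.sum_le_sum_of_subset_of_nonneg (Finset.subset_univ _)
        fun σ _ _ => (Real.exp_pos _).le

theorem card_level_le_abs (d n : ℕ) (x r : ℝ) :
    ((Finset.univ.filter fun σ : Config d n => totalWeight σ = r).card : ℝ)
      ≤ Real.exp (n * eta d x - x * |r|) := by
  rcases abs_choice r with h | h
  · rw [h]; exact card_level_le d n x r
  · have := card_level_le d n (-x) r
    rw [eta_neg] at this
    rw [h]
    convert this using 2
    ring

/-- The number of configurations of total weight `r` is bounded by the entropy. -/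
theorem card_level_le_entropy (hd : 1 ≤ d) (hn : n ≠ 0) {r : ℝ} (hr : |r| ≤ n * spin d) :
    ((Finset.univ.filter fun σ : Config d n => totalWeight σ = r).card : ℝ)
      ≤ Real.exp (n * g d 0 (|r| / n)) := by
  have hn0 : (0 : ℝ) < n := by exact_mod_cast Nat.pos_of_ne_zero hn
  have hr' : |r| / n ≤ spin d := by rw [div_le_iff₀ hn0]; linarith
  rcases hr'.lt_or_eq with hlt | heq
  -- The optimal tilt solves `η'(x) = |r|/n`; for `|r| = nS` there is none, and `x → ∞` gives the
  -- bound `1`.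
  · obtain ⟨x, hx, hxm⟩ := exists_deriv_eta_eq hd ⟨by positivity, hlt⟩
    refine (card_level_le_abs d n x r).trans_eq ?_
    rw [← hxm, g_deriv_eta hd, hxm]
    congr 1
    field_simp
    ring
  · rw [g, if_neg heq.not_lt, zero_mul, mul_zero, Real.exp_zero]
    have hlim : Tendsto (fun x => Real.exp (n * (eta d x - spin d * x))) atTop (𝓝 1) := by
      have := ((tendsto_eta_sub_atTop d).const_mul (n : ℝ))
      rw [mul_zero] at this
      rw [← Real.exp_zero]
      exact (Real.continuous_exp.tendsto 0).comp this
    refine ge_of_tendsto' hlim fun x => (card_level_le_abs d n x r).trans_eq ?_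
    rw [← heq]
    congr 1
    field_simp

theorem g_eq_add (d : ℕ) (β m : ℝ) : g d β m = g d 0 m + β * m ^ 2 := by
  unfold g
  split_ifs <;> ring

/-- Entropy, energy and field add up to at most `n (g_β(m) + h m)` at `m = |r|/n`. The linear part
`β r/n` of the energy costs only the constant `β S`. -/
theorem level_weight_le (hd : 1 ≤ d) (hn : n ≠ 0) {β h : ℝ} (hβ : 0 < β) (hh : 0 ≤ h) (r : ℝ) :
    Real.exp (β / n * (r * (r + 1)))
        * ((Finset.univ.filter fun σ : Config d n => totalWeight σ = r).card : ℝ)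
        * Real.exp (h * r)
      ≤ Real.exp (β * spin d + n * freeEnergy d β h) := by
  have hn0 : (0 : ℝ) < n := by exact_mod_cast Nat.pos_of_ne_zero hn
  rcases (Finset.univ.filter fun σ : Config d n => totalWeight σ = r).eq_empty_or_nonempty
    with he | ⟨σ, hσ⟩
  · rw [he]
    simp only [Finset.card_empty, Nat.cast_zero, mul_zero, zero_mul]
    exact (Real.exp_pos _).le
  · have hr : |r| ≤ n * spin d := by
      rw [← (Finset.mem_filter.1 hσ).2]
      exact abs_totalWeight_le σ
    have hm : |r| / n ∈ Set.Icc 0 (spin d) :=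
      ⟨by positivity, by rw [div_le_iff₀ hn0]; linarith⟩
    have h1 := g_add_le_freeEnergy hd hβ h hm
    rw [g_eq_add, abs_of_nonneg hh] at h1
    have h2 := mul_le_mul_of_nonneg_left h1 hn0.le
    calc _ ≤ Real.exp (β / n * (r * (r + 1))) * Real.exp (n * g d 0 (|r| / n))
          * Real.exp (h * r) := by
          gcongr
          exact card_level_le_entropy hd hn hr
      _ = Real.exp (β / n * (r * (r + 1)) + n * g d 0 (|r| / n) + h * r) := by
          rw [Real.exp_add, Real.exp_add]
      _ ≤ _ := by
          refine Real.exp_le_exp.2 ?_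
          have h3 : β / n * r ≤ β * spin d := by
            rw [div_mul_eq_mul_div, div_le_iff₀ hn0]
            nlinarith [le_abs_self r]
          have h4 : h * r ≤ h * |r| := mul_le_mul_of_nonneg_left (le_abs_self r) hh
          have h5 : n * (g d 0 (|r| / n) + β * (|r| / n) ^ 2 + h * (|r| / n))
              = n * g d 0 (|r| / n) + β / n * r ^ 2 + h * |r| := by
            rw [div_pow, sq_abs]
            field_simp
          have h6 : β / n * (r * (r + 1)) = β / n * r ^ 2 + β / n * r := by ring
          rw [h5] at h2
          linarith

/-- Descending induction from the top level `nS`, above which levels are empty. Each step down adds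
one exponential, because `exp (h r) ≤ exp (h (r+1))` for `h ≥ 0`. -/
theorem levelSum_mul_exp_le (hd : 1 ≤ d) (hn : n ≠ 0) {β h : ℝ} (hβ : 0 < β) (hh : 0 ≤ h)
    (k : ℕ) :
    levelSum (casimir d n) totalWeight (β / n) (n * spin d - k) * Real.exp (h * (n * spin d - k))
      ≤ (k + 1) * Real.exp (β * spin d + n * freeEnergy d β h) := by
  have hstep := fun r => levelSum_casimir_le (d := d) (n := n) (t := β / n) r
  have hlev := level_weight_le (n := n) hd hn hβ hh
  have hs0 : ∀ r, 0 ≤ levelSum (casimir d n) totalWeight (β / n) r := fun r =>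
    Finset.sum_nonneg fun σ _ => (diagExp_casimir_pos (by positivity) σ).le
  have hkey : ∀ r, levelSum (casimir d n) totalWeight (β / n) r * Real.exp (h * r)
      ≤ levelSum (casimir d n) totalWeight (β / n) (r + 1) * Real.exp (h * (r + 1))
        + Real.exp (β * spin d + n * freeEnergy d β h) := fun r => by
    have h1 := mul_le_mul_of_nonneg_right (hstep r) (Real.exp_pos (h * r)).le
    rw [add_mul] at h1
    have h2 : Real.exp (h * r) ≤ Real.exp (h * (r + 1)) := Real.exp_le_exp.2 (by nlinarith)
    have h3 := mul_le_mul_of_nonneg_left h2 (hs0 (r + 1))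
    linarith [hlev r]
  induction k with
  | zero =>
    have h1 := hkey (n * spin d)
    have h2 : levelSum (casimir d n) totalWeight (β / n) (n * spin d + 1) = 0 := by
      refine Finset.sum_eq_zero fun σ hσ => ?_
      have h3 := (Finset.mem_filter.1 hσ).2
      have h4 := (le_abs_self _).trans (abs_totalWeight_le σ)
      linarith
    rw [h2] at h1
    simpa using h1
  | succ k ih =>
    have h1 := hkey (n * spin d - (k + 1 : ℕ))
    rw [show (n : ℝ) * spin d - (k + 1 : ℕ) + 1 = n * spin d - k by push_cast; ring] at h1
    push_cast at h1 ⊢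
    linarith

theorem partitionSum_le (hd : 1 ≤ d) (hn : n ≠ 0) {β h : ℝ} (hβ : 0 < β) (hh : 0 ≤ h) :
    partitionSum d n (β / n) h
      ≤ ((n * d + 1 : ℕ) : ℝ) ^ 2 * Real.exp (β * spin d + n * freeEnergy d β h) := by
  have hmaps : ∀ σ ∈ (Finset.univ : Finset (Config d n)),
      (∑ i, (σ i : ℕ)) ∈ Finset.range (n * d + 1) := fun σ _ => by
    rw [Finset.mem_range, Nat.lt_succ_iff]
    refine (Finset.sum_le_card_nsmul _ _ d fun i _ => Nat.lt_succ_iff.1 (σ i).2).trans ?_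
    simp
  rw [partitionSum, ← Finset.sum_fiberwise_of_maps_to hmaps]
  have hfib : ∀ k : ℕ, (∑ σ : Config d n with ∑ i, (σ i : ℕ) = k,
      diagExp (casimir d n) (β / n) σ * Real.exp (h * totalWeight σ))
      = levelSum (casimir d n) totalWeight (β / n) (n * spin d - k)
        * Real.exp (h * (n * spin d - k)) := fun k => by
    rw [levelSum, Finset.sum_mul]
    have hf : (Finset.univ.filter fun σ : Config d n => ∑ i, (σ i : ℕ) = k)
        = Finset.univ.filter fun σ : Config d n => totalWeight σ = n * spin d - k := by
      ext σ
      simp only [Finset.mem_filter, Finset.mem_univ, true_and, totalWeight_eq, sub_right_inj,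
        Nat.cast_inj]
    rw [hf]
    refine Finset.sum_congr rfl fun σ hσ => ?_
    rw [(Finset.mem_filter.1 hσ).2]
  simp only [hfib]
  refine (Finset.sum_le_card_nsmul _ _ (((n * d + 1 : ℕ) : ℝ)
    * Real.exp (β * spin d + n * freeEnergy d β h)) fun k hk => ?_).trans_eq ?_
  · refine (levelSum_mul_exp_le hd hn hβ hh k).trans ?_
    gcongr
    exact_mod_cast Finset.mem_range.1 hk
  · rw [Finset.card_range, nsmul_eq_mul, sq, mul_assoc]

/-- From `(M - nm)² ≥ 0`, `βM²/n ≥ 2βmM - nβm²`, which makes the exponent linear in `M` with slope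
`2βm + h = x`. The sum is then `exp (n η(x))`, and `η(x) - βm²` is the free energy at the mean field
`x`. -/
theorem le_partitionSum (hd : 1 ≤ d) (hn : n ≠ 0) {β h : ℝ} (hβ : 0 < β) (hh : 0 ≤ h) :
    Real.exp (-(β * spin d) + n * freeEnergy d β h) ≤ partitionSum d n (β / n) h := by
  have hn0 : (0 : ℝ) < n := by exact_mod_cast Nat.pos_of_ne_zero hn
  set x := meanField d β h with hx
  set m := deriv (eta d) x with hm
  have hxe : x = 2 * β * m + h := meanField_eq hβ hh
  have hfe : freeEnergy d β h = eta d x - β * m ^ 2 := by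
    rw [freeEnergy, abs_of_nonneg hh, ← hx, g_deriv_eta hd, ← hm]
    conv_lhs => rw [show m * x = m * (2 * β * m + h) by rw [← hxe]]
    ring
  calc Real.exp (-(β * spin d) + n * freeEnergy d β h)
      = ∑ σ : Config d n, Real.exp (-(β * spin d) - n * β * m ^ 2)
          * Real.exp (x * totalWeight σ) := by
        rw [← Finset.mul_sum, sum_exp_totalWeight, ← Real.exp_add, hfe]
        congr 1
        ring
    _ ≤ partitionSum d n (β / n) h := by
        refine Finset.sum_le_sum fun σ _ => ?_
        refine le_trans ?_ (mul_le_mul_of_nonneg_right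
          (exp_le_diagExp_casimir (div_nonneg hβ.le hn0.le) σ) (Real.exp_pos _).le)
        rw [← Real.exp_add, ← Real.exp_add]
        refine Real.exp_le_exp.2 ?_
        set M := totalWeight σ
        have h1 := neg_abs_le M
        have h2 := abs_totalWeight_le σ
        have h3 : -(β * spin d) ≤ β / n * M := by
          rw [div_mul_eq_mul_div, le_div_iff₀ hn0]
          nlinarith
        have h4 : 0 ≤ β / n * (M - n * m) ^ 2 := by positivity
        have h5 : β / n * (M - n * m) ^ 2 = β / n * M ^ 2 - 2 * β * m * M + n * β * m ^ 2 := by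
          field_simp
          ring
        have h6 : x * M = 2 * β * m * M + h * M := by
          conv_lhs => rw [hxe]
          ring
        nlinarith

end Model

end

section

open Matrix

/-! ### The pressure -/

section Pressure

variable {d : ℕ} {β : ℝ}

theorem finitePressure_eq {n : ℕ} (hn : n ≠ 0) (hβ : 0 < β) (h : ℝ) :
    finitePressure d n β h
      = 1 / (n : ℝ)
        * (-(β * (spin d * (spin d + 1))) + Real.log (partitionSum d n (β / n) |h|)) := by
  rw [finitePressure, trace_gibbs hn, Complex.ofReal_re, Real.log_mul (Real.exp_pos _).ne'
    (partitionSum_pos (by positivity) _).ne', Real.log_exp]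

theorem tendsto_finitePressure (hd : 1 ≤ d) (hβ : 0 < β) (h : ℝ) :
    Tendsto (fun n : ℕ => finitePressure d n β h) atTop (𝓝 (freeEnergy d β h)) := by
  have hinv : Tendsto (fun n : ℕ => 1 / (n : ℝ)) atTop (𝓝 0) := tendsto_one_div_atTop_nhds_zero_nat
  have hlog : Tendsto (fun n : ℕ => Real.log n / n) atTop (𝓝 0) :=
    Real.isLittleO_log_id_atTop.tendsto_div_nhds_zero.comp tendsto_natCast_atTop_atTop
  set c := β * (spin d * (spin d + 1)) with hc
  have habs : freeEnergy d β |h| = freeEnergy d β h := by simp only [freeEnergy, abs_abs]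
  have hlow : Tendsto (fun n : ℕ => 1 / (n : ℝ) * (-c - β * spin d) + freeEnergy d β h) atTop
      (𝓝 (freeEnergy d β h)) := by
    simpa using (hinv.mul_const (-c - β * spin d)).add_const (freeEnergy d β h)
  have hup : Tendsto (fun n : ℕ => 1 / (n : ℝ) * (-c + 2 * Real.log (d + 1) + β * spin d)
      + 2 * (Real.log n / n) + freeEnergy d β h) atTop (𝓝 (freeEnergy d β h)) := by
    simpa using ((hinv.mul_const (-c + 2 * Real.log (d + 1) + β * spin d)).add
      (hlog.const_mul 2)).add_const (freeEnergy d β h)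
  refine tendsto_of_tendsto_of_tendsto_of_le_of_le' hlow hup ?_ ?_
  · filter_upwards [eventually_ne_atTop 0] with n hn
    have hn0 : (0 : ℝ) < n := by exact_mod_cast Nat.pos_of_ne_zero hn
    have h1 := Real.log_le_log (Real.exp_pos _) (le_partitionSum hd hn hβ (abs_nonneg h))
    rw [Real.log_exp, habs] at h1
    rw [finitePressure_eq hn hβ, ← hc]
    calc _ = 1 / (n : ℝ) * (-c + (-(β * spin d) + n * freeEnergy d β h)) := by field_simp; ring
      _ ≤ _ := mul_le_mul_of_nonneg_left (by linarith) (by positivity)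
  · filter_upwards [eventually_ne_atTop 0] with n hn
    have hn0 : (0 : ℝ) < n := by exact_mod_cast Nat.pos_of_ne_zero hn
    have hn1 : (1 : ℝ) ≤ n := by exact_mod_cast Nat.pos_of_ne_zero hn
    have h1 := Real.log_le_log (partitionSum_pos (by positivity) _)
      (partitionSum_le hd hn hβ (abs_nonneg h))
    rw [Real.log_mul (by positivity) (Real.exp_pos _).ne', Real.log_exp, Real.log_pow, habs] at h1
    have h2 : Real.log ((n * d + 1 : ℕ) : ℝ) ≤ Real.log n + Real.log (d + 1) := by
      rw [← Real.log_mul hn0.ne' (by positivity)]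
      refine Real.log_le_log (by positivity) ?_
      push_cast
      nlinarith
    rw [finitePressure_eq hn hβ, ← hc]
    calc _ ≤ 1 / (n : ℝ) * (-c + (2 * (Real.log n + Real.log (d + 1))
          + (β * spin d + n * freeEnergy d β h))) := by
          refine mul_le_mul_of_nonneg_left ?_ (by positivity)
          push_cast at h1 h2 ⊢
          linarith
      _ = _ := by field_simp; ring

theorem pressure_eq (hd : 1 ≤ d) (hβ : 0 < β) : pressure d β = freeEnergy d β :=
  funext fun h => (tendsto_finitePressure hd hβ h).limUnder_eq

theorem hasDerivAt_pressure (hd : 1 ≤ d) (hβ : 0 < β) {h : ℝ} (hh : h ≠ 0 ∨ β ≤ betaC d) :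
    HasDerivAt (fun t => pressure d β t) (deriv (eta d) (signedField d β h)) h := by
  have := hasDerivAt_freeEnergy_field hd hβ hh
  rwa [← pressure_eq hd hβ] at this

theorem magnetization_eq (hd : 1 ≤ d) (hβ : 0 < β) {h : ℝ} (hh : h ≠ 0 ∨ β ≤ betaC d) :
    magnetization d β h = deriv (eta d) (signedField d β h) :=
  (hasDerivAt_pressure hd hβ hh).deriv

theorem magnetization_eq_of_pos (hd : 1 ≤ d) (hβ : 0 < β) {h : ℝ} (hh : 0 < h) :
    magnetization d β h = deriv (eta d) (meanField d β h) := by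
  rw [magnetization_eq hd hβ (Or.inl hh.ne'), deriv_eta_signedField, abs_of_pos hh]
  simp [hh]

theorem hasDerivAt_magnetization (hd : 1 ≤ d) (hβ : 0 < β) (hc : β < betaC d) :
    HasDerivAt (fun t => magnetization d β t) (1 / 2 * (betaC d - β)⁻¹) 0 := by
  rw [show (fun t => magnetization d β t) = fun h => deriv (eta d) (signedField d β h) from
    funext fun h => magnetization_eq hd hβ (Or.inr hc.le)]
  exact hasDerivAt_deriv_eta_signedField hd hβ hc

/-! ### The finite-volume magnetization -/

/-- The Gibbs expectation of the total weight. -/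
def meanWeight (d n : ℕ) (t h : ℝ) : ℝ :=
  (∑ σ : Config d n, totalWeight σ * (diagExp (casimir d n) t σ * Real.exp (h * totalWeight σ)))
    / partitionSum d n t h

theorem abs_meanWeight_le {n : ℕ} {t : ℝ} (ht : 0 ≤ t) (h : ℝ) :
    |meanWeight d n t h| ≤ n * spin d := by
  have hZ := partitionSum_pos (d := d) (n := n) ht h
  rw [meanWeight, abs_div, abs_of_pos hZ, div_le_iff₀ hZ, partitionSum, Finset.mul_sum]
  refine (Finset.abs_sum_le_sum_abs _ _).trans (Finset.sum_le_sum fun σ _ => ?_)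
  have hp := (mul_pos (diagExp_casimir_pos ht σ) (Real.exp_pos (h * totalWeight σ))).le
  rw [abs_mul, abs_of_nonneg hp]
  exact mul_le_mul_of_nonneg_right (abs_totalWeight_le σ) hp

/-- Jensen's inequality for the Gibbs weights, from `1 + u ≤ exp u` centred at the mean. It makes
the finite-volume mean weight a subgradient of the log partition function. -/
theorem partitionSum_tangent {n : ℕ} {t : ℝ} (ht : 0 ≤ t) (h h' : ℝ) :
    partitionSum d n t h * Real.exp ((h' - h) * meanWeight d n t h) ≤ partitionSum d n t h' := by
  have hZ := partitionSum_pos (d := d) (n := n) ht h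
  set μ := meanWeight d n t h with hμ
  have hmean : (∑ σ : Config d n, totalWeight σ * (diagExp (casimir d n) t σ
      * Real.exp (h * totalWeight σ))) = μ * partitionSum d n t h := by
    rw [hμ, meanWeight, div_mul_cancel₀ _ hZ.ne']
  have hlin : ∑ σ : Config d n, (diagExp (casimir d n) t σ * Real.exp (h * totalWeight σ))
      * (1 + (h' - h) * (totalWeight σ - μ)) = partitionSum d n t h := by
    have : ∀ σ : Config d n, (diagExp (casimir d n) t σ * Real.exp (h * totalWeight σ))
        * (1 + (h' - h) * (totalWeight σ - μ))
        = (1 - (h' - h) * μ) * (diagExp (casimir d n) t σ * Real.exp (h * totalWeight σ))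
          + (h' - h) * (totalWeight σ * (diagExp (casimir d n) t σ
            * Real.exp (h * totalWeight σ))) := fun σ => by ring
    rw [Finset.sum_congr rfl fun σ _ => this σ, Finset.sum_add_distrib, ← Finset.mul_sum,
      ← Finset.mul_sum, hmean, ← partitionSum]
    ring
  conv_lhs => rw [← hlin]
  rw [Finset.sum_mul]
  refine Finset.sum_le_sum fun σ _ => ?_
  have h1 := Real.add_one_le_exp ((h' - h) * (totalWeight σ - μ))
  have h2 : Real.exp (h' * totalWeight σ) = Real.exp (h * totalWeight σ)
      * Real.exp ((h' - h) * (totalWeight σ - μ)) * Real.exp ((h' - h) * μ) := by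
    rw [← Real.exp_add, ← Real.exp_add]
    ring_nf
  have h3 := (mul_pos (diagExp_casimir_pos ht σ) (Real.exp_pos (h * totalWeight σ))).le
  rw [h2, ← mul_assoc, ← mul_assoc]
  refine mul_le_mul_of_nonneg_right ?_ (Real.exp_pos _).le
  exact mul_le_mul_of_nonneg_left (by linarith) h3

theorem finitePressure_tangent {n : ℕ} (hn : n ≠ 0) (hβ : 0 < β) {h h' : ℝ} (hh : 0 < h)
    (hh' : 0 < h') :
    finitePressure d n β h + (h' - h) * (meanWeight d n (β / n) h / n)
      ≤ finitePressure d n β h' := by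
  have hn0 : (0 : ℝ) < n := by exact_mod_cast Nat.pos_of_ne_zero hn
  have ht : 0 ≤ β / n := by positivity
  have hZ := partitionSum_pos (d := d) (n := n) ht h
  have h1 := Real.log_le_log (mul_pos hZ (Real.exp_pos _))
    (partitionSum_tangent (d := d) (n := n) ht h h')
  rw [Real.log_mul hZ.ne' (Real.exp_pos _).ne', Real.log_exp] at h1
  rw [finitePressure_eq hn hβ, finitePressure_eq hn hβ, abs_of_pos hh, abs_of_pos hh']
  calc _ = 1 / (n : ℝ) * (-(β * (spin d * (spin d + 1))) + (Real.log (partitionSum d n (β / n) h)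
        + (h' - h) * meanWeight d n (β / n) h)) := by field_simp; ring
    _ ≤ _ := mul_le_mul_of_nonneg_left (by linarith) (by positivity)

/-- Subgradients of functions converging pointwise converge at points of differentiability of the
limit. -/
theorem tendsto_subgradient {f : ℕ → ℝ → ℝ} {F : ℝ → ℝ} {m : ℕ → ℝ} {a F' : ℝ}
    (hf : ∀ᶠ x in 𝓝 a, Tendsto (fun n => f n x) atTop (𝓝 (F x)))
    (hF : HasDerivAt F F' a)
    (hsub : ∀ᶠ x in 𝓝 a, ∀ᶠ n in atTop, f n a + (x - a) * m n ≤ f n x) :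
    Tendsto m atTop (𝓝 F') := by
  have hslope := hasDerivAt_iff_tendsto_slope.1 hF
  have hfa := hf.self_of_nhds
  refine tendsto_order.2 ⟨fun b hb => ?_, fun b hb => ?_⟩
  · have hl : Tendsto (slope F a) (𝓝[<] a) (𝓝 F') :=
      hslope.mono_left (nhdsWithin_mono a (fun x (hx : x < a) => hx.ne))
    obtain ⟨x, ⟨hx1, hx2, hx3⟩, hxa⟩ := (((hl.eventually (lt_mem_nhds hb)).and
      ((hf.and hsub).filter_mono nhdsWithin_le_nhds)).and self_mem_nhdsWithin).exists
    have hxa : x < a := hxa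
    rw [slope_def_field, lt_div_iff_of_neg (by linarith)] at hx1
    have := (hx2.sub hfa).eventually (gt_mem_nhds hx1)
    filter_upwards [this, hx3] with n hn1 hn2
    nlinarith
  · have hl : Tendsto (slope F a) (𝓝[>] a) (𝓝 F') :=
      hslope.mono_left (nhdsWithin_mono a (fun x (hx : a < x) => hx.ne'))
    obtain ⟨x, ⟨hx1, hx2, hx3⟩, hxa⟩ := (((hl.eventually (gt_mem_nhds hb)).and
      ((hf.and hsub).filter_mono nhdsWithin_le_nhds)).and self_mem_nhdsWithin).exists
    have hxa : a < x := hxa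
    rw [slope_def_field, div_lt_iff₀ (by linarith)] at hx1
    have := (hx2.sub hfa).eventually (gt_mem_nhds hx1)
    filter_upwards [this, hx3] with n hn1 hn2
    nlinarith

theorem tendsto_meanWeight (hd : 1 ≤ d) (hβ : 0 < β) {h : ℝ} (hh : 0 < h) :
    Tendsto (fun n : ℕ => meanWeight d n (β / n) h / n) atTop (𝓝 (magnetization d β h)) := by
  have hder := hasDerivAt_freeEnergy_field hd hβ (Or.inl hh.ne')
  rw [← magnetization_eq hd hβ (Or.inl hh.ne')] at hder
  refine tendsto_subgradient (f := fun n => finitePressure d n β)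
    (Eventually.of_forall fun x => tendsto_finitePressure hd hβ x) hder ?_
  filter_upwards [lt_mem_nhds hh] with x hx
  filter_upwards [eventually_ne_atTop 0] with n hn
  exact finitePressure_tangent hn hβ hh hx

end Pressure

/-! ### The transverse susceptibility -/

section Ladder

variable {ι : Type*} [Fintype ι] [DecidableEq ι]

open scoped Matrix.Norms.Operator in
theorem exp_mul_ladder {Y A : Matrix ι ι ℂ} (hYA : Y * A - A * Y = A) (s : ℝ) :
    NormedSpace.exp (s • Y) * A = Real.exp s • (A * NormedSpace.exp (s • Y)) := by
  set F : ℝ → Matrix ι ι ℂ := fun s =>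
    Real.exp (-s) • (NormedSpace.exp (s • Y) * A * NormedSpace.exp (s • -Y)) with hF
  have hder : ∀ s, HasDerivAt F 0 s := fun s => by
    have h1 := hasDerivAt_exp_smul_const Y s
    have h2 := hasDerivAt_exp_smul_const' (-Y) s
    have h3 : HasDerivAt (fun s : ℝ => Real.exp (-s)) (-Real.exp (-s)) s := by
      simpa using (hasDerivAt_neg s).exp
    have alg : ∀ (c : ℝ) (E E' : Matrix ι ι ℂ),
        c • (E * Y * A * E' + E * A * (-Y * E')) + (-c) • (E * A * E') = 0 := fun c E E' => by
      have : E * Y * A * E' + E * A * (-Y * E') = E * (Y * A - A * Y) * E' := by noncomm_ring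
      rw [this, hYA]
      module
    exact (h3.smul ((h1.mul_const A).mul h2)).congr_deriv (alg _ _ _)
  have hc := is_const_of_deriv_eq_zero (fun s => (hder s).differentiableAt)
    (fun s => (hder s).deriv) s 0
  simp only [hF, neg_zero, Real.exp_zero, zero_smul, NormedSpace.exp_zero, one_smul, one_mul,
    mul_one] at hc
  rw [smul_neg, Matrix.exp_neg] at hc
  have hu := (isUnit_iff_isUnit_det _).1 (isUnit_exp (s • Y))
  conv_rhs => rw [← hc]
  rw [smul_mul_assoc, smul_smul, ← Real.exp_add, add_neg_cancel, Real.exp_zero, one_smul,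
    mul_assoc, nonsing_inv_mul _ hu, mul_one]

/-- The Ward identity: the transverse second moment is determined by the expectation of the
generator. -/
theorem trace_sq_mul_of_ladder {W T₁ T₂ T₃ : Matrix ι ι ℂ} {h : ℝ} (hh : 0 < h)
    (hW : Wᴴ = W) (hT₂ : T₂ᴴ = T₂) (hT₃ : T₃ᴴ = T₃)
    (hT : T₂ * T₃ - T₃ * T₂ = Complex.I • T₁)
    (hlad : W * (T₂ + Complex.I • T₃) = Real.exp h • ((T₂ + Complex.I • T₃) * W)) :
    (T₂ * T₂ * W).trace
      = (((Real.exp h + 1) / (2 * (Real.exp h - 1)) : ℝ) : ℂ) * (T₁ * W).trace := by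
  set A := T₂ + Complex.I • T₃ with hA
  have hAh : Aᴴ = T₂ - Complex.I • T₃ := by
    rw [hA, conjTranspose_add, conjTranspose_smul, hT₂, hT₃]
    simp [sub_eq_add_neg]
  have he : (1 : ℝ) < Real.exp h := Real.one_lt_exp_iff.2 hh
  have hne : (Real.exp h : ℂ) - 1 ≠ 0 := by
    have : ((Real.exp h - 1 : ℝ) : ℂ) ≠ 0 := Complex.ofReal_ne_zero.2 (by linarith)
    simpa using this
  -- Moving `A` around the trace costs a factor `exp h ≠ 1`. Hence the trace of `A A W` vanishes,
  -- and for `B = Aᴴ` the commutator `[A, Aᴴ] = 2T₁` determines both mixed traces.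
  have hcyc : ∀ B : Matrix ι ι ℂ, (A * B * W).trace = (Real.exp h : ℂ) * (B * A * W).trace :=
    fun B => by
      rw [mul_assoc A, trace_mul_comm, mul_assoc B, hlad, mul_smul_comm, trace_smul,
        Complex.real_smul, mul_assoc]
  have h1 : (A * A * W).trace = 0 := by
    have := hcyc A
    have h2 : ((Real.exp h : ℂ) - 1) * (A * A * W).trace = 0 := by linear_combination -this
    exact (mul_eq_zero.1 h2).resolve_left hne
  have h2 : (Aᴴ * Aᴴ * W).trace = 0 := by
    have : (Aᴴ * Aᴴ * W).trace = star (A * A * W).trace := by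
      rw [← trace_conjTranspose, conjTranspose_mul, conjTranspose_mul, hW, trace_mul_comm]
    rw [this, h1, star_zero]
  have h3 := hcyc Aᴴ
  have hI : Complex.I * Complex.I = -1 := Complex.I_mul_I
  have h4 : A * Aᴴ - Aᴴ * A = (2 : ℂ) • T₁ := by
    have : A * Aᴴ - Aᴴ * A = (-2 * Complex.I) • (T₂ * T₃ - T₃ * T₂) := by
      rw [hAh, hA]
      simp only [add_mul, mul_add, sub_mul, mul_sub, smul_mul_assoc, mul_smul_comm]
      module
    rw [this, hT, smul_smul]
    congr 1
    linear_combination -2 * hI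
  have h5 : (4 : ℂ) • (T₂ * T₂) = A * A + A * Aᴴ + Aᴴ * A + Aᴴ * Aᴴ := by
    have : (2 : ℂ) • T₂ = A + Aᴴ := by
      rw [hAh, hA]
      module
    have h6 : ((2 : ℂ) • T₂) * ((2 : ℂ) • T₂) = (4 : ℂ) • (T₂ * T₂) := by
      rw [smul_mul_assoc, mul_smul_comm, smul_smul]
      norm_num
    rw [← h6, this]
    noncomm_ring
  have h6 : (A * Aᴴ * W).trace - (Aᴴ * A * W).trace = 2 * (T₁ * W).trace := by
    rw [← trace_sub, ← sub_mul, h4, smul_mul_assoc, trace_smul, smul_eq_mul]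
  have h7 : 4 * (T₂ * T₂ * W).trace = (A * Aᴴ * W).trace + (Aᴴ * A * W).trace := by
    rw [← smul_eq_mul, ← trace_smul, ← smul_mul_assoc, h5]
    simp only [add_mul, trace_add, h1, h2]
    ring
  push_cast
  have hne2 : (2 : ℂ) * ((Real.exp h : ℂ) - 1) ≠ 0 := mul_ne_zero two_ne_zero hne
  push_cast at hne2 h3 hne
  rw [div_mul_eq_mul_div, eq_div_iff hne2]
  linear_combination ((Complex.exp h - 1) / 2) * h7 + (Complex.exp h + 1) / 2 * h6 - h3

end Ladder

section Transverse

variable {d n : ℕ}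

theorem total_spin3_spin1 :
    total n (spin3 d) * total n (spin1 d) - total n (spin1 d) * total n (spin3 d)
      = Complex.I • total n (spin2 d) := by
  have h1 := total_spin3_raise (d := d) (n := n)
  have h2 := total_spin3_lower (d := d) (n := n)
  have e : Complex.I * (1 / (2 * Complex.I)) = 1 / 2 := by
    field_simp
  rw [total_spin1, total_spin2, smul_smul, e]
  simp only [smul_mul_assoc, mul_smul_comm, mul_add, add_mul]
  linear_combination (norm := module) (1 / 2 : ℂ) • h1 + (1 / 2 : ℂ) • h2

theorem total_spin1_ladder :
    total n (spin1 d) * (total n (spin2 d) + Complex.I • total n (spin3 d))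
      - (total n (spin2 d) + Complex.I • total n (spin3 d)) * total n (spin1 d)
      = total n (spin2 d) + Complex.I • total n (spin3 d) := by
  have h1 := total_spin2_spin1 (d := d) (n := n)
  have h2 := congrArg (Complex.I • ·) (total_spin3_spin1 (d := d) (n := n))
  simp only [smul_smul, Complex.I_mul_I, smul_sub] at h2
  simp only [mul_add, add_mul, mul_smul_comm, smul_mul_assoc]
  linear_combination (norm := module) -h1 - h2

theorem gibbs_conjTranspose (hn : n ≠ 0) (β h : ℝ) : (gibbs d n β h)ᴴ = gibbs d n β h := by
  have h1 : ((β / n) • casimir d n + h • total n (spin1 d))ᴴ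
      = (β / n) • casimir d n + h • total n (spin1 d) := by
    rw [conjTranspose_add, conjTranspose_smul, conjTranspose_smul, casimir_conjTranspose,
      total_conjTranspose, spin1_conjTranspose]
    simp
  rw [gibbs_eq hn, conjTranspose_smul, ← exp_conjTranspose, h1]
  simp

theorem gibbs_mul_ladder (hn : n ≠ 0) (β h : ℝ) :
    gibbs d n β h * (total n (spin2 d) + Complex.I • total n (spin3 d))
      = Real.exp h • ((total n (spin2 d) + Complex.I • total n (spin3 d)) * gibbs d n β h) := by
  have hc : Commute (NormedSpace.exp ((β / n) • casimir d n))
      (total n (spin2 d) + Complex.I • total n (spin3 d)) :=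
    ((casimir_commute_spin2.add_right (casimir_commute_spin3.smul_right _)).smul_left _).exp_left
  rw [gibbs_eq hn, exp_add_of_commute _ _
    ((casimir_commute_spin1.smul_left (β / (n : ℝ))).smul_right h), smul_mul_assoc, mul_assoc,
    exp_mul_ladder total_spin1_ladder h, mul_smul_comm, mul_smul_comm, smul_comm]
  rw [← mul_assoc (NormedSpace.exp _), hc.eq, mul_assoc (total n (spin2 d) + _)]

theorem re_trace_site_sq_mul_gibbs_nonneg (hn : n ≠ 0) (β h : ℝ) (i : Fin n)
    {A : Matrix (Fin (d + 1)) (Fin (d + 1)) ℂ} (hA : Aᴴ = A) :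
    0 ≤ (site (A * A) i * gibbs d n β h).trace.re := by
  set X := (β / n) • casimir d n + h • total n (spin1 d) with hX
  have hXh : Xᴴ = X := by
    rw [hX, conjTranspose_add, conjTranspose_smul, conjTranspose_smul, casimir_conjTranspose,
      total_conjTranspose, spin1_conjTranspose]
    simp
  have hE : NormedSpace.exp X = NormedSpace.exp (((1 : ℝ) / 2) • X)
      * NormedSpace.exp (((1 : ℝ) / 2) • X) := by
    have := exp_smul_eq_half_mul_half X 1
    rwa [one_smul] at this
  have hEh := exp_smul_conjTranspose hXh (1 / 2)
  set E := NormedSpace.exp (((1 : ℝ) / 2) • X)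
  have h1 := re_trace_conjTranspose_mul_self_nonneg (site A i * E)
  have h2 : ((site A i * E)ᴴ * (site A i * E)).trace = (site (A * A) i * (E * E)).trace := by
    rw [conjTranspose_mul, hEh, site_conjTranspose, hA, mul_assoc, trace_mul_comm,
      ← site_mul_site_self]
    simp only [mul_assoc]
  rw [h2] at h1
  rw [gibbs_eq hn, ← hX, hE, mul_smul_comm, trace_smul, Complex.smul_re, smul_eq_mul]
  exact mul_nonneg (Real.exp_pos _).le h1

/-- The three squared components at a site sum to `S(S+1)`, and the other two have nonnegative trace
against the Gibbs operator. -/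
theorem re_trace_site_spin2_sq_le (hn : n ≠ 0) (β h : ℝ) (i : Fin n) :
    (site (spin2 d * spin2 d) i * gibbs d n β h).trace.re
      ≤ spin d * (spin d + 1) * (gibbs d n β h).trace.re := by
  have h1 := re_trace_site_sq_mul_gibbs_nonneg hn β h i (spin1_conjTranspose d)
  have h3 := re_trace_site_sq_mul_gibbs_nonneg hn β h i (spin3_conjTranspose d)
  have h := congrArg (fun A => (site A i * gibbs d n β h).trace.re) (spin_sq_sum d)
  simp only [site_add, site_smul, site_one, add_mul, trace_add, Complex.add_re, smul_mul_assoc,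
    one_mul, trace_smul, smul_eq_mul, Complex.re_ofReal_mul] at h
  linarith

/-- The transverse susceptibility is `(1/4) coth (h/2)` times the magnetization, up to a bounded
error. -/
theorem finiteTransverse_bounds (hn : n ≠ 0) {β h : ℝ} (hβ : 0 < β) (hh : 0 < h) :
    (Real.exp h + 1) / (4 * (Real.exp h - 1)) * (meanWeight d n (β / n) h / n)
        - spin d * (spin d + 1) / 2 ≤ finiteTransverse d n β h ∧
      finiteTransverse d n β h
        ≤ (Real.exp h + 1) / (4 * (Real.exp h - 1)) * (meanWeight d n (β / n) h / n) := by
  have hn0 : (0 : ℝ) < n := by exact_mod_cast Nat.pos_of_ne_zero hn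
  have hZ := partitionSum_pos (d := d) (n := n) (t := β / n) (by positivity) h
  set c := Real.exp (-(β * (spin d * (spin d + 1)))) with hc
  have hc0 : 0 < c := Real.exp_pos _
  set w := c * partitionSum d n (β / n) h with hw
  have hw0 : 0 < w := mul_pos hc0 hZ
  have htr : (gibbs d n β h).trace = (w : ℂ) := by
    rw [trace_gibbs hn, abs_of_pos hh]
  have hT1 : (total n (spin1 d) * gibbs d n β h).trace
      = ((meanWeight d n (β / n) h * w : ℝ) : ℂ) := by
    rw [gibbs_eq hn, mul_smul_comm, trace_smul, trace_spin1_mul_exp _ hh, Complex.real_smul,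
      ← Complex.ofReal_mul, hw, meanWeight, ← hc, mul_left_comm,
      div_mul_cancel₀ _ hZ.ne']
  have hT2 := trace_sq_mul_of_ladder (T₁ := total n (spin1 d)) hh
    (gibbs_conjTranspose (d := d) hn β h)
    (by rw [total_conjTranspose, spin2_conjTranspose])
    (by rw [total_conjTranspose, spin3_conjTranspose]) total_spin2_spin3 (gibbs_mul_ladder hn β h)
  rw [hT1, ← Complex.ofReal_mul] at hT2
  have hsum : (∑ i : Fin n, ∑ j ∈ Finset.Ioi i,
      ((site (spin2 d) i * site (spin2 d) j * gibbs d n β h).trace / (gibbs d n β h).trace).re)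
      = (((total n (spin2 d) * total n (spin2 d) * gibbs d n β h).trace.re
        - ∑ i : Fin n, (site (spin2 d * spin2 d) i * gibbs d n β h).trace.re) / 2) / w := by
    simp only [htr, Complex.div_ofReal_re]
    rw [total_mul_total, add_mul, trace_add, Complex.add_re, total, Finset.sum_mul, trace_sum,
      Complex.re_sum, add_sub_cancel_left, smul_mul_assoc, trace_smul, smul_eq_mul,
      show (2 : ℂ) = ((2 : ℝ) : ℂ) by norm_num, Complex.re_ofReal_mul,
      mul_div_cancel_left₀ _ two_ne_zero]
    simp only [Finset.sum_mul, trace_sum, Complex.re_sum, Finset.sum_div]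
  have hlow : 0 ≤ ∑ i : Fin n, (site (spin2 d * spin2 d) i * gibbs d n β h).trace.re :=
    Finset.sum_nonneg fun i _ =>
      re_trace_site_sq_mul_gibbs_nonneg hn β h i (spin2_conjTranspose d)
  have hup : (∑ i : Fin n, (site (spin2 d * spin2 d) i * gibbs d n β h).trace.re)
      ≤ n * (spin d * (spin d + 1) * w) := by
    refine (Finset.sum_le_card_nsmul _ _ (spin d * (spin d + 1) * w) fun i _ => ?_).trans_eq ?_
    · have := re_trace_site_spin2_sq_le (d := d) hn β h i
      rwa [htr, Complex.ofReal_re] at this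
    · simp
  set Q := ∑ i : Fin n, (site (spin2 d * spin2 d) i * gibbs d n β h).trace.re
  have he : (1 : ℝ) < Real.exp h := Real.one_lt_exp_iff.2 hh
  have he' : Real.exp h - 1 ≠ 0 := by linarith
  have heq : finiteTransverse d n β h
      = (Real.exp h + 1) / (4 * (Real.exp h - 1)) * (meanWeight d n (β / n) h / n)
        - Q / (2 * n * w) := by
    rw [finiteTransverse, hsum, hT2, Complex.ofReal_re]
    field_simp
    ring
  rw [heq]
  constructor
  · have : Q / (2 * n * w) ≤ spin d * (spin d + 1) / 2 := by
      rw [div_le_div_iff₀ (by positivity) (by norm_num)]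
      nlinarith
    linarith
  · have : 0 ≤ Q / (2 * n * w) := by positivity
    linarith

theorem exists_isTransverseSusceptibility {β h : ℝ} (hβ : 0 < β) (hh : 0 < h) :
    ∃ L, IsTransverseSusceptibility d β h L := by
  set c := (Real.exp h + 1) / (4 * (Real.exp h - 1)) with hc
  have he : (1 : ℝ) < Real.exp h := Real.one_lt_exp_iff.2 hh
  have hc0 : 0 < c := div_pos (by linarith) (by linarith)
  -- The shift avoids the empty volume, where the bounds do not apply.
  have hb : ∀ n : ℕ, finiteTransverse d (n + 1) β h
      ∈ Set.Icc (-(c * spin d) - spin d * (spin d + 1) / 2) (c * spin d) := fun n => by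
    have hn0 : (0 : ℝ) < (n + 1 : ℕ) := by positivity
    obtain ⟨h1, h2⟩ := finiteTransverse_bounds (d := d) (n.succ_ne_zero) hβ hh
    have h3 := abs_le.1 (abs_meanWeight_le (d := d) (n := n + 1) (t := β / (n + 1 : ℕ))
      (by positivity) h)
    have h4 : meanWeight d (n + 1) (β / (n + 1 : ℕ)) h / (n + 1 : ℕ) ≤ spin d := by
      rw [div_le_iff₀ hn0]
      linarith [h3.2]
    have h5 : -spin d ≤ meanWeight d (n + 1) (β / (n + 1 : ℕ)) h / (n + 1 : ℕ) := by
      rw [le_div_iff₀ hn0]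
      linarith [h3.1]
    have h6 := mul_le_mul_of_nonneg_left h4 hc0.le
    have h7 := mul_le_mul_of_nonneg_left h5 hc0.le
    exact ⟨by linarith, by linarith⟩
  obtain ⟨L, -, φ, hφ, hL⟩ := isCompact_Icc.tendsto_subseq hb
  exact ⟨L, fun k => φ k + 1, fun a b hab => Nat.add_lt_add_right (hφ hab) 1, hL⟩

theorem isTransverseSusceptibility_bounds (hd : 1 ≤ d) {β h L : ℝ} (hβ : 0 < β) (hh : 0 < h)
    (hL : IsTransverseSusceptibility d β h L) :
    (Real.exp h + 1) / (4 * (Real.exp h - 1)) * magnetization d β h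
        - spin d * (spin d + 1) / 2 ≤ L ∧
      L ≤ (Real.exp h + 1) / (4 * (Real.exp h - 1)) * magnetization d β h := by
  obtain ⟨φ, hφ, hlim⟩ := hL
  have hm := ((tendsto_meanWeight hd hβ hh).comp hφ.tendsto_atTop).const_mul
    ((Real.exp h + 1) / (4 * (Real.exp h - 1)))
  have hev : ∀ᶠ k in atTop, φ k ≠ 0 := hφ.tendsto_atTop.eventually (eventually_ne_atTop 0)
  constructor
  · refine le_of_tendsto_of_tendsto (hm.sub_const _) hlim ?_
    filter_upwards [hev] with k hk
    exact (finiteTransverse_bounds hk hβ hh).1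
  · refine le_of_tendsto_of_tendsto hlim hm ?_
    filter_upwards [hev] with k hk
    exact (finiteTransverse_bounds hk hβ hh).2

/-- The asymptotics of the transverse susceptibility follow from those of the magnetization. -/
theorem tendsto_transverse_mul {α : ℝ} (hα : 0 < α) {c : ℝ} {m X : ℝ → ℝ}
    {K : ℝ} (hm : Tendsto (fun h => m h / h ^ (1 - α)) (𝓝[>] 0) (𝓝 c))
    (hX : ∀ h, 0 < h → (Real.exp h + 1) / (4 * (Real.exp h - 1)) * m h - K ≤ X h ∧
      X h ≤ (Real.exp h + 1) / (4 * (Real.exp h - 1)) * m h) :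
    Tendsto (fun h => X h / h ^ (-α)) (𝓝[>] 0) (𝓝 (c / 2)) := by
  have hid : Tendsto (fun h : ℝ => h) (𝓝[>] 0) (𝓝 0) := nhdsWithin_le_nhds
  have hexp : Tendsto (fun h : ℝ => (Real.exp h - 1) / h) (𝓝[>] 0) (𝓝 1) := by
    have h1 := hasDerivAt_iff_tendsto_slope.1 (Real.hasDerivAt_exp 0)
    have h2 := h1.mono_left (nhdsWithin_mono 0 (fun x (hx : 0 < x) => hx.ne'))
    rw [Real.exp_zero] at h2
    refine h2.congr fun x => ?_
    simp [slope_def_field]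
  have hnum : Tendsto (fun h : ℝ => (Real.exp h + 1) / 4) (𝓝[>] 0) (𝓝 (1 / 2)) := by
    have h1 : Tendsto (fun h : ℝ => (Real.exp h + 1) / 4) (𝓝 0) (𝓝 ((Real.exp 0 + 1) / 4)) :=
      Continuous.tendsto (by fun_prop) 0
    rw [Real.exp_zero] at h1
    norm_num at h1
    norm_num
    exact h1.mono_left nhdsWithin_le_nhds
  -- The prefactor `(1/4) coth (h/2)` behaves like `1/(2h)`. The bounded error `K` becomes `K h^α`
  -- after rescaling and vanishes since `α > 0`.
  have hmain := (hnum.div hexp one_ne_zero).mul hm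
  rw [div_one, one_div_mul_eq_div] at hmain
  have herr : Tendsto (fun h : ℝ => K * h ^ α) (𝓝[>] 0) (𝓝 0) := by
    have := (hid.rpow_const (p := α) (Or.inr hα.le)).const_mul K
    rwa [Real.zero_rpow hα.ne', mul_zero] at this
  have hsub := hmain.sub herr
  rw [sub_zero] at hsub
  have hrw : ∀ h : ℝ, 0 < h → (Real.exp h + 1) / 4 / ((Real.exp h - 1) / h) * (m h / h ^ (1 - α))
      = (Real.exp h + 1) / (4 * (Real.exp h - 1)) * m h * h ^ α := fun h hh => by
    have he : (1 : ℝ) < Real.exp h := Real.one_lt_exp_iff.2 hh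
    have he' : Real.exp h - 1 ≠ 0 := by linarith
    have hp := (Real.rpow_pos_of_pos hh α).ne'
    rw [Real.rpow_sub hh, Real.rpow_one]
    field_simp
  refine tendsto_of_tendsto_of_tendsto_of_le_of_le' hsub hmain ?_ ?_
  · filter_upwards [self_mem_nhdsWithin] with h hh
    have hh : 0 < h := hh
    have hp := (Real.rpow_pos_of_pos hh α).le
    simp only [Pi.div_apply]
    rw [hrw h hh, Real.rpow_neg hh.le, div_inv_eq_mul]
    have := mul_le_mul_of_nonneg_right (hX h hh).1 hp
    linarith
  · filter_upwards [self_mem_nhdsWithin] with h hh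
    have hh : 0 < h := hh
    have hp := (Real.rpow_pos_of_pos hh α).le
    simp only [Pi.div_apply]
    rw [hrw h hh, Real.rpow_neg hh.le, div_inv_eq_mul]
    exact mul_le_mul_of_nonneg_right (hX h hh).2 hp

end Transverse

end

end Heisenberg

end

/-! ### The main theorem -/

theorem theorem2p4 (d : ℕ) (hd : 1 ≤ d) :
    -- the pressure exists and is given by the variational formula
    (∀ β : ℝ, 0 < β → ∀ h : ℝ,
      Tendsto (fun n : ℕ => Heisenberg.finitePressure d n β h) atTop
        (𝓝 (Heisenberg.pressure d β h)) ∧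
      IsGreatest ((fun m => Heisenberg.g d β m + |h| * m) '' Set.Icc 0 (Heisenberg.spin d))
        (Heisenberg.pressure d β h)) ∧
    -- the quantities whose exponents are computed are well defined
    (∀ β : ℝ, 0 < β →
      Heisenberg.IsMaximiser d β (Heisenberg.mStar d β) ∧
      ∀ m : ℝ, Heisenberg.IsMaximiser d β m → m = Heisenberg.mStar d β) ∧
    (∀ β h : ℝ, 0 < β → (h ≠ 0 ∨ β ≤ Heisenberg.betaC d) →
      DifferentiableAt ℝ (fun t => Heisenberg.pressure d β t) h) ∧
    (∀ β : ℝ, 0 < β → β < Heisenberg.betaC d →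
      DifferentiableAt ℝ (fun t => Heisenberg.magnetization d β t) 0) ∧
    (∀ β h : ℝ, 0 < β → 0 < h → ∃ L : ℝ, Heisenberg.IsTransverseSusceptibility d β h L) ∧
    -- critical exponents
    Heisenberg.Sim (𝓝[>] (Heisenberg.betaC d)) (fun β => Heisenberg.mStar d β)
      (fun β => (β - Heisenberg.betaC d) ^ (1 / 2 : ℝ)) ∧
    Heisenberg.Sim (𝓝[<] (Heisenberg.betaC d)) (fun β => Heisenberg.susceptibility d β)
      (fun β => (Heisenberg.betaC d - β) ^ (-1 : ℝ)) ∧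
    Heisenberg.Sim (𝓝[>] 0) (fun h => Heisenberg.magnetization d (Heisenberg.betaC d) h)
      (fun h => h ^ (1 / 3 : ℝ)) ∧
    -- transverse susceptibility, for every choice of subsequential limits
    (∀ X : ℝ → ℝ,
      (∀ h : ℝ, 0 < h →
        Heisenberg.IsTransverseSusceptibility d (Heisenberg.betaC d) h (X h)) →
      Heisenberg.Sim (𝓝[>] 0) X (fun h => h ^ (-(2 / 3) : ℝ))) ∧
    (∀ β : ℝ, Heisenberg.betaC d < β → ∀ X : ℝ → ℝ,
      (∀ h : ℝ, 0 < h → Heisenberg.IsTransverseSusceptibility d β h (X h)) →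
      Heisenberg.Sim (𝓝[>] 0) X (fun h => h ^ (-1 : ℝ))) := by
  have hc := Heisenberg.betaC_pos hd
  have hcub := Heisenberg.cubicCoeff_pos hd
  have hmag : Tendsto (fun h => Heisenberg.magnetization d (Heisenberg.betaC d) h / h ^ (1 / 3 : ℝ))
      (𝓝[>] 0) (𝓝 (1 / (2 * Heisenberg.betaC d)
        * (1 / (2 * Heisenberg.betaC d * Heisenberg.cubicCoeff d)) ^ (1 / 3 : ℝ))) := by
    refine (Heisenberg.tendsto_meanField_div hd).congr' ?_
    filter_upwards [self_mem_nhdsWithin] with h hh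
    rw [Heisenberg.magnetization_eq_of_pos hd hc hh]
  refine ⟨fun β hβ h => ?_, fun β hβ => ?_, fun β h hβ hh => ?_, fun β hβ hβc => ?_,
    fun β h hβ hh => Heisenberg.exists_isTransverseSusceptibility hβ hh, ?_, ?_, ?_, ?_, ?_⟩
  · rw [Heisenberg.pressure_eq hd hβ]
    exact ⟨Heisenberg.tendsto_finitePressure hd hβ h, Heisenberg.isGreatest_freeEnergy hd hβ h⟩
  · have h := Heisenberg.isMaximiser_iff hd hβ
    rw [← Heisenberg.mStar_eq hd hβ] at h
    exact ⟨(h _).2 rfl, fun m => (h m).1⟩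
  · exact (Heisenberg.hasDerivAt_pressure hd hβ hh).differentiableAt
  · exact (Heisenberg.hasDerivAt_magnetization hd hβ hβc).differentiableAt
  · exact ⟨_, by positivity, Heisenberg.tendsto_mStar_div hd⟩
  -- The quotient is constant: `χ(β) = 1/(2(β_c - β))` for all `0 < β < β_c`.
  · refine ⟨1 / 2, by norm_num, tendsto_const_nhds.congr' ?_⟩
    filter_upwards [Ioo_mem_nhdsLT hc] with β hβ
    rw [Heisenberg.susceptibility, (Heisenberg.hasDerivAt_magnetization hd hβ.1 hβ.2).deriv,
      Real.rpow_neg_one, mul_div_cancel_right₀]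
    exact inv_ne_zero (by linarith [hβ.2])
  · exact ⟨_, by positivity, hmag⟩
  · intro X hX
    rw [show (1 / 3 : ℝ) = 1 - 2 / 3 by norm_num] at hmag
    exact ⟨_, by positivity, Heisenberg.tendsto_transverse_mul (α := 2 / 3) (by norm_num) hmag
      fun h hh => Heisenberg.isTransverseSusceptibility_bounds hd hc hh (hX h hh)⟩
  · intro β hβ X hX
    have hβ0 := hc.trans hβ
    -- With `α = 1` the magnetization is divided by `h^0 = 1`; its limit is the spontaneous
    -- magnetization, positive above `β_c`.
    refine ⟨_, half_pos (Heisenberg.deriv_eta_pos hd (Heisenberg.meanField_pos_of_betaC_lt hd hβ)),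
      Heisenberg.tendsto_transverse_mul (α := 1) one_pos (m := Heisenberg.magnetization d β) ?_
      fun h hh => Heisenberg.isTransverseSusceptibility_bounds hd hβ0 hh (hX h hh)⟩
    have h1 : Tendsto (fun h => Heisenberg.meanField d β h) (𝓝[>] 0)
        (𝓝 (Heisenberg.meanField d β 0)) :=
      Heisenberg.tendsto_meanField hd hβ0 le_rfl tendsto_const_nhds nhdsWithin_le_nhds
        (by filter_upwards [self_mem_nhdsWithin] with h hh using le_of_lt hh)
    refine (((Heisenberg.continuous_deriv_eta d).tendsto _).comp h1).congr' ?_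
    filter_upwards [self_mem_nhdsWithin] with h hh
    rw [Heisenberg.magnetization_eq_of_pos hd hβ0 hh]
    simp
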